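/- \textbf{Setting.} Let $M$ be a smooth manifold with a pair of complementary smooth distributions $\widetilde{\mathcal D}$, $\mathcal D$ of ranks $n$ and $p$, so $TM=\widetilde{\mathcal D}\oplus\mathcal D$, and let $g$ be an adapted Riemannian metric, i.e. $g(\widetilde{\mathcal D},\mathcal D)=0$. Let $\nabla$ be its Levi-Civita connection and $R^\nabla(X,Y)=\nabla_Y\nabla_X-\nabla_X\nabla_Y+\nabla_{[X,Y]}$. Write $X^\top$, $X^\perp$ for the components of $X$ in $\widetilde{\mathcal D}$, $\mathcal D$, and let $\{E_a\}_{a\le n}$, $\{\mathcal E_i\}_{i\le p}$ be local orthonormal frames of $\widetilde{\mathcal D}$, $\mathcal D$. \textbf{Notation.} The second fundamental forms and integrability tensors are $h=\frac12(\nabla_XY+\nabla_YX)^\perp$, $T=\frac12[X,Y]^\perp$ for $X,Y\in\widetilde{\mathcal D}$, and $\tilde h=\frac12(\nabla_XY+\nabla_YX)^\top$, $\tilde T=\frac12[X,Y]^\top$ for $X,Y\in\mathcal D$; these tensors are extended by zero to all other arguments. Put $H=\operatorname{Tr}_g h$, $\tilde H=\operatorname{Tr}_g\tilde h$. The operators $A_Z,T^\sharp_Z$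 on $\widetilde{\mathcal D}$ ($Z\in\mathcal D$) are given by $g(A_ZX,Y)=g(h(X,Y),Z)$, $g(T^\sharp_ZX,Y)=g(T(X,Y),Z)$, and $\tilde A_Z,\tilde T^\sharp_Z$ on $\mathcal D$ ($Z\in\widetilde{\mathcal D}$) similarly from $\tilde h,\tilde T$; an index $a$ or $i$ means $Z=E_a$ or $Z=\mathcal E_i$. Put $$\mathcal A=\sum_i A_i^2,\quad \mathcal T=\sum_i (T_i^\sharp)^2,\quad \widetilde{\mathcal A}=\sum_a\tilde A_a^2,\quad \widetilde{\mathcal T}=\sum_a(\tilde T_a^\sharp)^2,$$ $$\Psi(X,Y)=\operatorname{Tr}(A_YA_X+T^\sharp_YT^\sharp_X)\ (X,Y\in\mathcal D),\qquad \widetilde\Psi(X,Y)=\operatorname{Tr}(\tilde A_Y\tilde A_X+\tilde T^\sharp_Y\tilde T^\sharp_X)\ (X,Y\in\widetilde{\mathcal D}),$$ and $S^\flat(X,Y)=g(SX,Y)$ for an operator $S$. For a $(1,2)$-tensor $P$ and a vector field $\xi$ put $\langle P,\xi\rangle(X,Y)=g(P(X,Y),\xi)$, $$(\widetilde{\operatorname{div}}\,P)(X,Y)=\sum_a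 g((\nabla_{E_a}P)(X,Y),E_a),\qquad (\operatorname{div}^\perp P)(X,Y)=\sum_i g((\nabla_{\mathcal E_i}P)(X,Y),\mathcal E_i),$$ $\operatorname{div}P=\widetilde{\operatorname{div}}\,P+\operatorname{div}^\perp P$; $\operatorname{div}\xi=\operatorname{Tr}\nabla\xi$. For a vector field $\xi$ let $$2\operatorname{Def}\xi(X,Y)=g(\nabla_X\xi,Y)+g(\nabla_Y\xi,X),\qquad 2\,d\xi(X,Y)=g(\nabla_X\xi,Y)-g(\nabla_Y\xi,X),$$ with subscript $\mathcal D$ or $\widetilde{\mathcal D}$ for the restriction to that distribution. The partial Ricci tensors are $r_{\mathcal D}(X,Y)=\sum_a g(R^\nabla(E_a,X^\perp)E_a,Y^\perp)$ and $r_{\widetilde{\mathcal D}}(X,Y)=\sum_i g(R^\nabla(\mathcal E_i,X^\top)\mathcal E_i,Y^\top)$, and $\mathrm S_{\rm mix}=\sum_{a,i}g(R^\nabla(E_a,\mathcal E_i)E_a,\mathcal E_i)$. \textbf{Proposition.} At every point of $M$, for all arguments in $\mathcal D$, $$r_{\mathcal D}-\operatorname{div}\tilde h-\langle\tilde h,\tilde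 H\rangle+\widetilde{\mathcal A}^\flat+\widetilde{\mathcal T}^\flat+\Psi-\operatorname{Def}_{\mathcal D}H=0,$$ $$d_{\mathcal D}H+\widetilde{\operatorname{div}}\,\tilde T-\sum_a(\tilde A_a\tilde T^\sharp_a+\tilde T^\sharp_a\tilde A_a)^\flat=0;$$ for all arguments in $\widetilde{\mathcal D}$, $$r_{\widetilde{\mathcal D}}-\operatorname{div}h-\langle h,H\rangle+\mathcal A^\flat+\mathcal T^\flat+\widetilde\Psi-\operatorname{Def}_{\widetilde{\mathcal D}}\tilde H=0,$$ $$d_{\widetilde{\mathcal D}}\tilde H+\operatorname{div}^\perp T-\sum_i(A_iT^\sharp_i+T^\sharp_iA_i)^\flat=0;$$ and $$\mathrm S_{\rm mix}=\|H\|^2-\|h\|^2+\|T\|^2+\|\tilde H\|^2-\|\tilde h\|^2+\|\tilde T\|^2+\operatorname{div}(H+\tilde H),$$ where $\|h\|^2=\sum_{a,b}\|h(E_a,E_b)\|^2$, $\|T\|^2=\sum_{a,b}\|T(E_a,E_b)\|^2$, $\|\tilde h\|^2=\sum_{i,j}\|\tilde h(\mathcal E_i,\mathcal E_j)\|^2$,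 $\|\tilde T\|^2=\sum_{i,j}\|\tilde T(\mathcal E_i,\mathcal E_j)\|^2$. -/

import Mathlib

open Bundle Module FiberBundle VectorField
open scoped Manifold ContDiff Topology RealInnerProductSpace

set_option linter.unusedSectionVars false

namespace AlmostProduct

noncomputable section

/-! `M` is a smooth manifold without boundary modelled on the finite-dimensional space `E`, with a
smooth Riemannian metric on its tangent bundle. -/

variable {E : Type*} [NormedAddCommGroup E] [NormedSpace ℝ E] [FiniteDimensional ℝ E]
  {M : Type*} [TopologicalSpace M] [ChartedSpace E M] [IsManifold 𝓘(ℝ, E) ∞ M]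
  [RiemannianBundle (fun x : M ↦ TangentSpace 𝓘(ℝ, E) x)]
  [IsContMDiffRiemannianBundle 𝓘(ℝ, E) ∞ E (fun x : M ↦ TangentSpace 𝓘(ℝ, E) x)]

/-! ### The Levi-Civita connection and its curvature -/

theorem mdifferentiableAt_inner {Y Z : Π x : M, TangentSpace 𝓘(ℝ, E) x} {x : M}
    (hY : MDiffAt (T% Y) x) (hZ : MDiffAt (T% Z) x) :
    MDiffAt (fun y ↦ ⟪Y y, Z y⟫) x :=
  MDifferentiableAt.inner_bundle (F := E) (E := fun x : M ↦ TangentSpace 𝓘(ℝ, E) x) hY hZ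

/-- The right-hand side of the Koszul formula for `2 ⟪∇_X Y, Z⟫`. -/
def koszul (X Y Z : Π x : M, TangentSpace 𝓘(ℝ, E) x) (x : M) : ℝ :=
  mvfderiv 𝓘(ℝ, E) (fun y ↦ ⟪Y y, Z y⟫) x (X x) + mvfderiv 𝓘(ℝ, E) (fun y ↦ ⟪Z y, X y⟫) x (Y x)
    - mvfderiv 𝓘(ℝ, E) (fun y ↦ ⟪X y, Y y⟫) x (Z x)
    + ⟪mlieBracket 𝓘(ℝ, E) X Y x, Z x⟫ - ⟪mlieBracket 𝓘(ℝ, E) Y Z x, X x⟫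
    + ⟪mlieBracket 𝓘(ℝ, E) Z X x, Y x⟫

theorem koszul_tensorial_left (Y Z : Π x : M, TangentSpace 𝓘(ℝ, E) x) {x : M}
    (hY : MDiffAt (T% Y) x) (hZ : MDiffAt (T% Z) x) :
    TensorialAt 𝓘(ℝ, E) E (fun X ↦ koszul X Y Z x) x where
  smul {f X} hf hX := by
    have e1 : (fun y ↦ ⟪Z y, (f • X) y⟫) = fun y ↦ f y * ⟪Z y, X y⟫ := by
      ext y; simp [inner_smul_right]
    have e2 : (fun y ↦ ⟪(f • X) y, Y y⟫) = fun y ↦ f y * ⟪X y, Y y⟫ := by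
      ext y; simp [inner_smul_left]
    simp only [koszul]
    rw [e1, e2, mvfderiv_fun_mul hf (mdifferentiableAt_inner hZ hX), mvfderiv_fun_mul hf (mdifferentiableAt_inner hX hY),
      mlieBracket_smul_left hf hX, mlieBracket_smul_right hf hX]
    simp [inner_smul_left, inner_smul_right, inner_add_left, real_inner_comm]
    ring
  add {X X'} hX hX' := by
    have e1 : (fun y ↦ ⟪Z y, (X + X') y⟫) = fun y ↦ ⟪Z y, X y⟫ + ⟪Z y, X' y⟫ := by
      ext y; simp [inner_add_right]
    have e2 : (fun y ↦ ⟪(X + X') y, Y y⟫) = fun y ↦ ⟪X y, Y y⟫ + ⟪X' y, Y y⟫ := by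
      ext y; simp [inner_add_left]
    simp only [koszul]
    rw [e1, e2, mvfderiv_fun_add (mdifferentiableAt_inner hZ hX) (mdifferentiableAt_inner hZ hX'),
      mvfderiv_fun_add (mdifferentiableAt_inner hX hY) (mdifferentiableAt_inner hX' hY),
      mlieBracket_add_left hX hX', mlieBracket_add_right hX hX']
    simp [inner_add_left, inner_add_right]
    ring

theorem koszul_tensorial_right (X Y : Π x : M, TangentSpace 𝓘(ℝ, E) x) {x : M}
    (hX : MDiffAt (T% X) x) (hY : MDiffAt (T% Y) x) :
    TensorialAt 𝓘(ℝ, E) E (fun Z ↦ koszul X Y Z x) x where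
  smul {f Z} hf hZ := by
    have e1 : (fun y ↦ ⟪Y y, (f • Z) y⟫) = fun y ↦ f y * ⟪Y y, Z y⟫ := by
      ext y; simp [inner_smul_right]
    have e2 : (fun y ↦ ⟪(f • Z) y, X y⟫) = fun y ↦ f y * ⟪Z y, X y⟫ := by
      ext y; simp [inner_smul_left]
    simp only [koszul]
    rw [e1, e2, mvfderiv_fun_mul hf (mdifferentiableAt_inner hY hZ), mvfderiv_fun_mul hf (mdifferentiableAt_inner hZ hX),
      mlieBracket_smul_left hf hZ, mlieBracket_smul_right hf hZ]
    simp [inner_smul_left, inner_smul_right, inner_add_left, real_inner_comm]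
    ring
  add {Z Z'} hZ hZ' := by
    have e1 : (fun y ↦ ⟪Y y, (Z + Z') y⟫) = fun y ↦ ⟪Y y, Z y⟫ + ⟪Y y, Z' y⟫ := by
      ext y; simp [inner_add_right]
    have e2 : (fun y ↦ ⟪(Z + Z') y, X y⟫) = fun y ↦ ⟪Z y, X y⟫ + ⟪Z' y, X y⟫ := by
      ext y; simp [inner_add_left]
    simp only [koszul]
    rw [e1, e2, mvfderiv_fun_add (mdifferentiableAt_inner hY hZ) (mdifferentiableAt_inner hY hZ'),
      mvfderiv_fun_add (mdifferentiableAt_inner hZ hX) (mdifferentiableAt_inner hZ' hX),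
      mlieBracket_add_left hZ hZ', mlieBracket_add_right hZ hZ']
    simp [inner_add_left, inner_add_right]
    ring

open Classical in
/-- For a field `Y` differentiable at `x`, the bilinear form on `T_x M` induced by `koszul · Y ·`;
it is set to `0` when `Y` is not differentiable at `x`. -/
def koszulForm (Y : Π x : M, TangentSpace 𝓘(ℝ, E) x) (x : M) :
    TangentSpace 𝓘(ℝ, E) x →L[ℝ] TangentSpace 𝓘(ℝ, E) x →L[ℝ] ℝ :=
  if hY : MDiffAt (T% Y) x then
    TensorialAt.mkHom₂ (fun X Z ↦ koszul X Y Z x) x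
      (fun Z hZ ↦ koszul_tensorial_left Y Z hY hZ) (fun X hX ↦ koszul_tensorial_right X Y hX hY)
  else 0

theorem koszulForm_apply {X Y Z : Π x : M, TangentSpace 𝓘(ℝ, E) x} {x : M}
    (hX : MDiffAt (T% X) x) (hY : MDiffAt (T% Y) x) (hZ : MDiffAt (T% Z) x) :
    koszulForm Y x (X x) (Z x) = koszul X Y Z x := by
  simp only [koszulForm, dif_pos hY]
  exact TensorialAt.mkHom₂_apply _ _ hX hZ

instance instFiniteDimensionalTangent (x : M) : FiniteDimensional ℝ (TangentSpace 𝓘(ℝ, E) x) := inferInstanceAs (FiniteDimensional ℝ E)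
instance instCompleteSpaceTangent (x : M) : CompleteSpace (TangentSpace 𝓘(ℝ, E) x) := FiniteDimensional.complete ℝ _


/-- `∇ Y` at `x`: the endomorphism of `T_x M` with `2 ⟪∇_v Y, w⟫ = koszulForm Y x v w`. -/
def lcFun (Y : Π x : M, TangentSpace 𝓘(ℝ, E) x) (x : M) :
    TangentSpace 𝓘(ℝ, E) x →L[ℝ] TangentSpace 𝓘(ℝ, E) x :=
  LinearMap.toContinuousLinearMap
    { toFun := fun v ↦ (1 / 2 : ℝ) •
        (InnerProductSpace.toDual ℝ (TangentSpace 𝓘(ℝ, E) x)).symm (koszulForm Y x v)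
      map_add' := fun v w ↦ by simp
      map_smul' := fun c v ↦ by simp [smul_comm c] }

theorem inner_lcFun (Y : Π x : M, TangentSpace 𝓘(ℝ, E) x) (x : M) (v w : TangentSpace 𝓘(ℝ, E) x) :
    ⟪lcFun Y x v, w⟫ = 1 / 2 * koszulForm Y x v w := by
  simp [lcFun, inner_smul_left]

theorem inner_lcFun_field {X Y Z : Π x : M, TangentSpace 𝓘(ℝ, E) x} {x : M}
    (hX : MDiffAt (T% X) x) (hY : MDiffAt (T% Y) x) (hZ : MDiffAt (T% Z) x) :
    ⟪lcFun Y x (X x), Z x⟫ = 1 / 2 * koszul X Y Z x := by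
  rw [inner_lcFun, koszulForm_apply hX hY hZ]

theorem lc_ext {x : M} {A B : TangentSpace 𝓘(ℝ, E) x →L[ℝ] TangentSpace 𝓘(ℝ, E) x}
    (h : ∀ X Z : Π x : M, TangentSpace 𝓘(ℝ, E) x, MDiffAt (T% X) x → MDiffAt (T% Z) x →
      ⟪A (X x), Z x⟫ = ⟪B (X x), Z x⟫) : A = B := by
  ext v
  refine ext_inner_right ℝ fun w ↦ ?_
  simpa using h (extend E v) (extend E w) (mdifferentiableAt_extend ..)
    (mdifferentiableAt_extend ..)

/-- The Levi-Civita connection of the Riemannian metric on `M`; `leviCivita Y x v` is `∇_v Y`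
at `x`, for `v` in `T_x M`. -/
def leviCivita : CovariantDerivative 𝓘(ℝ, E) E (fun x : M ↦ TangentSpace 𝓘(ℝ, E) x) where
  toFun := lcFun
  isCovariantDerivativeOnUniv :=
    { add := by
        intro Y Y' x hY hY' _
        refine lc_ext fun X Z hX hZ ↦ ?_
        have e1 : (fun y ↦ ⟪(Y + Y') y, Z y⟫) = fun y ↦ ⟪Y y, Z y⟫ + ⟪Y' y, Z y⟫ := by
          ext y; simp [inner_add_left]
        have e2 : (fun y ↦ ⟪X y, (Y + Y') y⟫) = fun y ↦ ⟪X y, Y y⟫ + ⟪X y, Y' y⟫ := by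
          ext y; simp [inner_add_right]
        rw [inner_lcFun_field hX (mdifferentiableAt_add_section hY hY') hZ]
        simp only [_root_.add_apply, inner_add_left]
        rw [inner_lcFun_field hX hY hZ, inner_lcFun_field hX hY' hZ]
        simp only [koszul]
        rw [e1, e2, mvfderiv_fun_add (mdifferentiableAt_inner hY hZ) (mdifferentiableAt_inner hY' hZ),
          mvfderiv_fun_add (mdifferentiableAt_inner hX hY) (mdifferentiableAt_inner hX hY'),
          mlieBracket_add_left hY hY', mlieBracket_add_right hY hY']
        simp [inner_add_left, inner_add_right]
        ring
      leibniz := by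
        intro Y f x hY hf _
        refine lc_ext fun X Z hX hZ ↦ ?_
        have e1 : (fun y ↦ ⟪(f • Y) y, Z y⟫) = fun y ↦ f y * ⟪Y y, Z y⟫ := by
          ext y; simp [inner_smul_left]
        have e2 : (fun y ↦ ⟪X y, (f • Y) y⟫) = fun y ↦ f y * ⟪X y, Y y⟫ := by
          ext y; simp [inner_smul_right]
        rw [inner_lcFun_field hX (hf.smul_section hY) hZ]
        simp only [_root_.add_apply, inner_add_left]
        simp only [_root_.smul_apply, inner_smul_left]
        rw [inner_lcFun_field hX hY hZ]
        simp only [koszul]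
        rw [e1, e2, mvfderiv_fun_mul hf (mdifferentiableAt_inner hY hZ),
          mvfderiv_fun_mul hf (mdifferentiableAt_inner hX hY),
          mlieBracket_smul_left hf hY, mlieBracket_smul_right hf hY]
        simp [inner_smul_left, inner_smul_right, inner_add_left, real_inner_comm]
        ring }

/-- The Levi-Civita connection is torsion-free. -/
theorem leviCivita_torsion : (leviCivita (E := E) (M := M)).torsion = 0 := by
  rw [CovariantDerivative.torsion_eq_zero_iff]
  intro X Y x hX hY
  refine ext_inner_right ℝ fun w ↦ ?_
  obtain ⟨Z, hZ, rfl⟩ : ∃ Z : Π x : M, TangentSpace 𝓘(ℝ, E) x, MDiffAt (T% Z) x ∧ Z x = w :=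
    ⟨extend E w, mdifferentiableAt_extend .., by simp⟩
  rw [inner_sub_left]
  have h1 := inner_lcFun_field hX hY hZ
  have h2 := inner_lcFun_field hY hX hZ
  simp only [leviCivita]
  rw [h1, h2]
  simp only [koszul]
  rw [mlieBracket_swap_apply (V := Y) (W := X), mlieBracket_swap_apply (V := Z) (W := Y),
    mlieBracket_swap_apply (V := Z) (W := X)]
  simp only [real_inner_comm, inner_neg_left]
  ring

/-- The Levi-Civita connection is compatible with the metric. -/
theorem leviCivita_metric {X Y Z : Π x : M, TangentSpace 𝓘(ℝ, E) x} {x : M}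
    (hX : MDiffAt (T% X) x) (hY : MDiffAt (T% Y) x) (hZ : MDiffAt (T% Z) x) :
    mvfderiv 𝓘(ℝ, E) (fun y ↦ ⟪Y y, Z y⟫) x (X x)
      = ⟪leviCivita Y x (X x), Z x⟫ + ⟪Y x, leviCivita Z x (X x)⟫ := by
  have h1 := inner_lcFun_field hX hY hZ
  have h2 := inner_lcFun_field hX hZ hY
  simp only [leviCivita]
  rw [real_inner_comm (lcFun Z x (X x)), h1, h2]
  simp only [koszul]
  rw [mlieBracket_swap_apply (V := Z) (W := Y), mlieBracket_swap_apply (V := Y) (W := X),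
    mlieBracket_swap_apply (V := Z) (W := X)]
  simp only [real_inner_comm, inner_neg_left]
  ring

/-- `R(X, Y) Z = ∇_Y ∇_X Z - ∇_X ∇_Y Z + ∇_[X, Y] Z` for vector fields. -/
def curvatureField (X Y Z : Π x : M, TangentSpace 𝓘(ℝ, E) x) (x : M) : TangentSpace 𝓘(ℝ, E) x :=
  leviCivita (fun y ↦ leviCivita Z y (X y)) x (Y x)
    - leviCivita (fun y ↦ leviCivita Z y (Y y)) x (X x)
    + leviCivita Z x (mlieBracket 𝓘(ℝ, E) X Y x)

/-- The curvature tensor `R(u, v) w` at `x`, computed from smooth local extensions of `u, v, w`. -/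
def curvature (x : M) (u v w : TangentSpace 𝓘(ℝ, E) x) : TangentSpace 𝓘(ℝ, E) x :=
  curvatureField (extend E u) (extend E v) (extend E w) x

/-- The divergence of a vector field. -/
def divergence (ξ : Π x : M, TangentSpace 𝓘(ℝ, E) x) (x : M) : ℝ :=
  ∑ k, ⟪leviCivita ξ x (stdOrthonormalBasis ℝ (TangentSpace 𝓘(ℝ, E) x) k),
    stdOrthonormalBasis ℝ (TangentSpace 𝓘(ℝ, E) x) k⟫

/-- The covariant derivative `(∇_v S)(X, Y)` at `x` of a `(1, 2)`-tensor field `S`, with `X, Y`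
extended to local vector fields. -/
def covDerivTensor
    (S : Π x : M, TangentSpace 𝓘(ℝ, E) x → TangentSpace 𝓘(ℝ, E) x → TangentSpace 𝓘(ℝ, E) x)
    (x : M) (v X Y : TangentSpace 𝓘(ℝ, E) x) : TangentSpace 𝓘(ℝ, E) x :=
  leviCivita (fun y ↦ S y (extend E X y) (extend E Y y)) x v
    - S x (leviCivita (extend E X) x v) Y - S x X (leviCivita (extend E Y) x v)

/-- The divergence of a `(1, 2)`-tensor field, a `(0, 2)`-tensor field. -/
def divTensor
    (S : Π x : M, TangentSpace 𝓘(ℝ, E) x → TangentSpace 𝓘(ℝ, E) x → TangentSpace 𝓘(ℝ, E) x)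
    (x : M) (X Y : TangentSpace 𝓘(ℝ, E) x) : ℝ :=
  ∑ k, ⟪covDerivTensor S x (stdOrthonormalBasis ℝ (TangentSpace 𝓘(ℝ, E) x) k) X Y,
    stdOrthonormalBasis ℝ (TangentSpace 𝓘(ℝ, E) x) k⟫

/-! ### Distributions -/

/-- `D` is a smooth distribution of rank `k`: near every point it is spanned by `k` smooth,
pointwise linearly independent vector fields. -/
def IsSmoothDistribution (k : ℕ) (D : Π x : M, Submodule ℝ (TangentSpace 𝓘(ℝ, E) x)) : Prop :=
  ∀ x : M, ∃ (U : Set M) (s : Fin k → Π y : M, TangentSpace 𝓘(ℝ, E) y),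
    IsOpen U ∧ x ∈ U ∧
    (∀ i, ContMDiffOn 𝓘(ℝ, E) (𝓘(ℝ, E).prod 𝓘(ℝ, E)) ∞
      (fun y ↦ (⟨y, s i y⟩ : TangentBundle 𝓘(ℝ, E) M)) U) ∧
    ∀ y ∈ U, LinearIndependent ℝ (fun i ↦ s i y) ∧
      Submodule.span ℝ (Set.range fun i ↦ s i y) = D y

/-- A pair of complementary smooth distributions `Dt` (of rank `n`) and `D` (of rank `p`) for which
the metric of `M` is adapted, i.e. which are orthogonal to each other. -/
structure IsAdaptedPair (n p : ℕ) (Dt D : Π x : M, Submodule ℝ (TangentSpace 𝓘(ℝ, E) x)) :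
    Prop where
  smooth_left : IsSmoothDistribution n Dt
  smooth_right : IsSmoothDistribution p D
  isCompl : ∀ x, IsCompl (Dt x) (D x)
  adapted : ∀ x, ∀ v ∈ Dt x, ∀ w ∈ D x, ⟪v, w⟫ = 0

/-! In what follows `(P, Q)` is either `(Dt, D)` or `(D, Dt)`. -/

/-- The component in `P` of a tangent vector. As the two distributions are complementary and
orthogonal, this is the orthogonal projection. -/
def proj (P : Π x : M, Submodule ℝ (TangentSpace 𝓘(ℝ, E) x)) (x : M) :
    TangentSpace 𝓘(ℝ, E) x →L[ℝ] TangentSpace 𝓘(ℝ, E) x :=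
  (P x).starProjection

/-- An orthonormal basis of `P x`. It is only used to write traces, which do not depend on it. -/
def onb (P : Π x : M, Submodule ℝ (TangentSpace 𝓘(ℝ, E) x)) (x : M)
    (a : Fin (finrank ℝ (P x))) : TangentSpace 𝓘(ℝ, E) x :=
  (stdOrthonormalBasis ℝ (P x) a : P x)

/-- A local vector field in `P` whose value at `x` is the component of `v` in `P`. -/
def extendIn (P : Π x : M, Submodule ℝ (TangentSpace 𝓘(ℝ, E) x)) {x : M}
    (v : TangentSpace 𝓘(ℝ, E) x) (y : M) : TangentSpace 𝓘(ℝ, E) y :=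
  proj P y (extend E v y)

/-- The second fundamental form of `P`, with values in `Q`:
`(1/2) (∇_X Y + ∇_Y X)^Q` for fields `X, Y` in `P`, extended to all tangent vectors by projecting
the arguments to `P`. -/
def secondForm (P Q : Π x : M, Submodule ℝ (TangentSpace 𝓘(ℝ, E) x)) (x : M)
    (u v : TangentSpace 𝓘(ℝ, E) x) : TangentSpace 𝓘(ℝ, E) x :=
  (1 / 2 : ℝ) • proj Q x (leviCivita (extendIn P v) x (proj P x u)
    + leviCivita (extendIn P u) x (proj P x v))

/-- The integrability tensor of `P`, with values in `Q`: `(1/2) [X, Y]^Q` for fields `X, Y` in `P`,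
extended to all tangent vectors by projecting the arguments to `P`. -/
def integrability (P Q : Π x : M, Submodule ℝ (TangentSpace 𝓘(ℝ, E) x)) (x : M)
    (u v : TangentSpace 𝓘(ℝ, E) x) : TangentSpace 𝓘(ℝ, E) x :=
  (1 / 2 : ℝ) • proj Q x (mlieBracket 𝓘(ℝ, E) (extendIn P u) (extendIn P v) x)

/-- The mean curvature vector field of `P`, the trace of its second fundamental form. -/
def meanCurvature (P Q : Π x : M, Submodule ℝ (TangentSpace 𝓘(ℝ, E) x)) (x : M) :
    TangentSpace 𝓘(ℝ, E) x :=
  ∑ a, secondForm P Q x (onb P x a) (onb P x a)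

/-- The endomorphism `X ↦ S_Z X` of `P x` dual to a tensor `S : P × P → Q` and a vector `Z`:
`⟪S_Z X, Y⟫ = ⟪S(X, Y), Z⟫` for `Y` in `P x`. -/
def dualOp (P : Π x : M, Submodule ℝ (TangentSpace 𝓘(ℝ, E) x))
    (S : Π x : M, TangentSpace 𝓘(ℝ, E) x → TangentSpace 𝓘(ℝ, E) x → TangentSpace 𝓘(ℝ, E) x)
    (x : M) (Z X : TangentSpace 𝓘(ℝ, E) x) : TangentSpace 𝓘(ℝ, E) x :=
  ∑ a, ⟪S x X (onb P x a), Z⟫ • onb P x a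

/-- The Weingarten operator `A_Z` of `P`, for `Z` in `Q`. -/
def weingarten (P Q : Π x : M, Submodule ℝ (TangentSpace 𝓘(ℝ, E) x)) (x : M)
    (Z X : TangentSpace 𝓘(ℝ, E) x) : TangentSpace 𝓘(ℝ, E) x :=
  dualOp P (secondForm P Q) x Z X

/-- The operator `T^♯_Z` dual to the integrability tensor of `P`, for `Z` in `Q`. -/
def integrabilitySharp (P Q : Π x : M, Submodule ℝ (TangentSpace 𝓘(ℝ, E) x)) (x : M)
    (Z X : TangentSpace 𝓘(ℝ, E) x) : TangentSpace 𝓘(ℝ, E) x :=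
  dualOp P (integrability P Q) x Z X

/-- The `(0, 2)`-tensor of the Casorati operator `∑ A_Z²` of `P`, where `Z` runs through an
orthonormal basis of `Q`. -/
def casoratiA (P Q : Π x : M, Submodule ℝ (TangentSpace 𝓘(ℝ, E) x)) (x : M)
    (X Y : TangentSpace 𝓘(ℝ, E) x) : ℝ :=
  ⟪∑ i, weingarten P Q x (onb Q x i) (weingarten P Q x (onb Q x i) X), Y⟫

/-- The `(0, 2)`-tensor of the Casorati operator `∑ (T^♯_Z)²` of `P`, where `Z` runs through an
orthonormal basis of `Q`. -/
def casoratiT (P Q : Π x : M, Submodule ℝ (TangentSpace 𝓘(ℝ, E) x)) (x : M)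
    (X Y : TangentSpace 𝓘(ℝ, E) x) : ℝ :=
  ⟪∑ i, integrabilitySharp P Q x (onb Q x i) (integrabilitySharp P Q x (onb Q x i) X), Y⟫

/-- The `(0, 2)`-tensor of `∑ (A_Z T^♯_Z + T^♯_Z A_Z)`, where `Z` runs through an orthonormal basis
of `Q`. -/
def mixedAT (P Q : Π x : M, Submodule ℝ (TangentSpace 𝓘(ℝ, E) x)) (x : M)
    (X Y : TangentSpace 𝓘(ℝ, E) x) : ℝ :=
  ⟪∑ i, (weingarten P Q x (onb Q x i) (integrabilitySharp P Q x (onb Q x i) X)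
    + integrabilitySharp P Q x (onb Q x i) (weingarten P Q x (onb Q x i) X)), Y⟫

/-- `Ψ(X, Y) = Tr (A_Y A_X + T^♯_Y T^♯_X)`, the trace over `P`, for `X, Y` in `Q`. -/
def psi (P Q : Π x : M, Submodule ℝ (TangentSpace 𝓘(ℝ, E) x)) (x : M)
    (X Y : TangentSpace 𝓘(ℝ, E) x) : ℝ :=
  ∑ a, ⟪weingarten P Q x Y (weingarten P Q x X (onb P x a))
    + integrabilitySharp P Q x Y (integrabilitySharp P Q x X (onb P x a)), onb P x a⟫

/-- The partial Ricci tensor concentrated on `Q`: `∑ ⟪R(e_a, X^Q) e_a, Y^Q⟫`, where the `e_a` form an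
orthonormal basis of `P`. -/
def partialRicci (P Q : Π x : M, Submodule ℝ (TangentSpace 𝓘(ℝ, E) x)) (x : M)
    (X Y : TangentSpace 𝓘(ℝ, E) x) : ℝ :=
  ∑ a, ⟪curvature x (onb P x a) (proj Q x X) (onb P x a), proj Q x Y⟫

/-- The mixed scalar curvature. -/
def mixedScalar (P Q : Π x : M, Submodule ℝ (TangentSpace 𝓘(ℝ, E) x)) (x : M) : ℝ :=
  ∑ a, ∑ i, ⟪curvature x (onb P x a) (onb Q x i) (onb P x a), onb Q x i⟫

/-- The `P`-divergence `∑ ⟪(∇_{e_a} S)(X, Y), e_a⟫` of a `P`-valued `(1, 2)`-tensor field `S`, where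
the `e_a` form an orthonormal basis of `P`. -/
def partialDivTensor (P : Π x : M, Submodule ℝ (TangentSpace 𝓘(ℝ, E) x))
    (S : Π x : M, TangentSpace 𝓘(ℝ, E) x → TangentSpace 𝓘(ℝ, E) x → TangentSpace 𝓘(ℝ, E) x)
    (x : M) (X Y : TangentSpace 𝓘(ℝ, E) x) : ℝ :=
  ∑ a, ⟪covDerivTensor S x (onb P x a) X Y, onb P x a⟫

/-- The deformation tensor of a vector field: the symmetric part of `∇ ξ`. -/
def deformation (ξ : Π x : M, TangentSpace 𝓘(ℝ, E) x) (x : M) (X Y : TangentSpace 𝓘(ℝ, E) x) : ℝ :=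
  (1 / 2) * (⟪leviCivita ξ x X, Y⟫ + ⟪leviCivita ξ x Y, X⟫)

/-- The antisymmetric part of `∇ ξ`. -/
def antisymDeriv (ξ : Π x : M, TangentSpace 𝓘(ℝ, E) x) (x : M) (X Y : TangentSpace 𝓘(ℝ, E) x) : ℝ :=
  (1 / 2) * (⟪leviCivita ξ x X, Y⟫ - ⟪leviCivita ξ x Y, X⟫)

/-- The squared norm `∑ ‖S(e_a, e_b)‖²` of a tensor on `P`. -/
def sqNorm (P : Π x : M, Submodule ℝ (TangentSpace 𝓘(ℝ, E) x))
    (S : Π x : M, TangentSpace 𝓘(ℝ, E) x → TangentSpace 𝓘(ℝ, E) x → TangentSpace 𝓘(ℝ, E) x)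
    (x : M) : ℝ :=
  ∑ a, ∑ b, ‖S x (onb P x a) (onb P x b)‖ ^ 2

end

end AlmostProduct

open AlmostProduct

/-!
The five identities are the symmetric part, the antisymmetric part and the trace of one Riccati
equation, applied to `(Dt, D)` and to `(D, Dt)`.

For an orthogonal pair `(P, Q)` put `B(X, Y) = (∇_X Y)^Q` for fields `X, Y` in `P`. This is a tensor
(`secondFund`); its symmetric part is the second fundamental form of `P` and, as `∇` is
torsion-free, its antisymmetric part is the integrability tensor of `P`. Let `C` be the
corresponding tensor of `Q`. Differentiating `⟪F, Y⟫ = 0` for `F` in `P` and `Y` in `Q` expresses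
the mixed components of `∇` by `B` and `C`, and the definition of the curvature becomes, for fields
`A, F` in `P` and `X, Y` in `Q` (`IsAdaptedPair.inner_curvatureField`),
`⟪R(A, X) F, Y⟫ = ⟪(∇_X B)(A, F), Y⟫ + ⟪(∇_A C)(X, Y), F⟫ + ⟪B(∇_A X, F), Y⟫ + ⟪C(∇_X A, Y), F⟫`.
Take `A = F = e_a` and sum over an orthonormal frame of `P`. The connection coefficients of the
frame are antisymmetric, so the first term becomes `⟪∇_X H, Y⟫`; the second one is the
`P`-divergence of `C`; the last two are quadratic in `B` and in `C`, and splitting into symmetric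
and antisymmetric parts turns them into `-Ψ` and minus the two Casorati terms and the mixed term.
This is `IsAdaptedPair.partialRicci_eq`.

The partial Ricci tensor is symmetric, by the first Bianchi identity and the skew-symmetry of
`R(X, Y)` (`inner_curvature_symm`). Hence the symmetric part of the equation is the first identity
of each pair: the full divergence of the second fundamental form of `Q` differs from its
`P`-divergence by the term with the mean curvature of `Q` (`IsAdaptedPair.divTensor_secondForm`).
The antisymmetric part is the second identity, and the trace over `Q` is the formula for the mixed
scalar curvature.

All this needs local smooth orthonormal frames of the distributions, which come from the
Gram-Schmidt process and also give the smoothness of the projections and of `∇`. The relation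
`[X, Y] f = X (Y f) - Y (X f)`, needed for the skew-symmetry of the curvature, is deduced from the
Jacobi identity (`mvfderiv_mlieBracket`).
-/

namespace AlmostProduct

noncomputable section

variable {E : Type*} [NormedAddCommGroup E] [NormedSpace ℝ E] [FiniteDimensional ℝ E]
  {M : Type*} [TopologicalSpace M] [ChartedSpace E M] [IsManifold 𝓘(ℝ, E) ∞ M]
  [RiemannianBundle (fun x : M ↦ TangentSpace 𝓘(ℝ, E) x)]
  [IsContMDiffRiemannianBundle 𝓘(ℝ, E) ∞ E (fun x : M ↦ TangentSpace 𝓘(ℝ, E) x)]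

section SmoothFields

/-! ### Smooth fields and functions near a point -/

/-- A vector field is smooth on a neighbourhood of `x`. Being `C^∞` at the single point `x` would only
give `C^k` neighbourhoods depending on `k`. -/
def SmoothNear (X : Π x : M, TangentSpace 𝓘(ℝ, E) x) (x : M) : Prop :=
  ∀ᶠ y in 𝓝 x, CMDiffAt ∞ (T% X) y

/-- A real function is smooth on a neighbourhood of `x`. -/
def SmoothFunNear (f : M → ℝ) (x : M) : Prop :=
  ∀ᶠ y in 𝓝 x, CMDiffAt ∞ f y

namespace SmoothFunNear

variable {f g : M → ℝ} {x : M}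

theorem mdiffAt (hf : SmoothFunNear (E := E) f x) : MDiffAt f x :=
  (Filter.Eventually.self_of_nhds hf).mdifferentiableAt (by simp)

theorem eventually (hf : SmoothFunNear (E := E) f x) :
    ∀ᶠ y in 𝓝 x, SmoothFunNear (E := E) f y :=
  eventually_eventually_nhds.2 hf

theorem const (c : ℝ) : SmoothFunNear (E := E) (fun _ : M ↦ c) x :=
  Filter.Eventually.of_forall fun _ ↦ contMDiffAt_const

theorem add (hf : SmoothFunNear (E := E) f x) (hg : SmoothFunNear (E := E) g x) :
    SmoothFunNear (E := E) (fun y ↦ f y + g y) x := by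
  filter_upwards [hf, hg] with y h1 h2 using h1.add h2

theorem sub (hf : SmoothFunNear (E := E) f x) (hg : SmoothFunNear (E := E) g x) :
    SmoothFunNear (E := E) (fun y ↦ f y - g y) x := by
  filter_upwards [hf, hg] with y h1 h2 using h1.sub h2

theorem mul (hf : SmoothFunNear (E := E) f x) (hg : SmoothFunNear (E := E) g x) :
    SmoothFunNear (E := E) (fun y ↦ f y * g y) x := by
  filter_upwards [hf, hg] with y h1 h2 using h1.mul h2

theorem inv (hf : SmoothFunNear (E := E) f x) (h : f x ≠ 0) :
    SmoothFunNear (E := E) (fun y ↦ (f y)⁻¹) x := by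
  filter_upwards [hf, hf.mdiffAt.continuousAt.eventually_ne h] with y h1 h2 using h1.inv₀ h2

theorem sqrt (hf : SmoothFunNear (E := E) f x) (h : f x ≠ 0) :
    SmoothFunNear (E := E) (fun y ↦ √(f y)) x := by
  filter_upwards [hf, hf.mdiffAt.continuousAt.eventually_ne h] with y h1 h2
  exact ContDiffAt.comp_contMDiffAt (Real.contDiffAt_sqrt h2) h1

theorem congr (hf : SmoothFunNear (E := E) f x) (h : ∀ᶠ y in 𝓝 x, g y = f y) :
    SmoothFunNear (E := E) g x := by
  filter_upwards [hf, eventually_eventually_nhds.2 h] with y h1 h2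
  exact h1.congr_of_eventuallyEq h2

end SmoothFunNear

namespace SmoothNear

variable {X Y : Π x : M, TangentSpace 𝓘(ℝ, E) x} {f : M → ℝ} {x : M}

theorem mdiffAt (hX : SmoothNear X x) : MDiffAt (T% X) x :=
  (Filter.Eventually.self_of_nhds hX).mdifferentiableAt (by simp)

theorem eventually (hX : SmoothNear X x) : ∀ᶠ y in 𝓝 x, SmoothNear X y :=
  eventually_eventually_nhds.2 hX

theorem congr (hX : SmoothNear X x) (h : ∀ᶠ y in 𝓝 x, Y y = X y) : SmoothNear Y x := by
  filter_upwards [hX, eventually_eventually_nhds.2 h] with y h1 h2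
  refine h1.congr_of_eventuallyEq ?_
  filter_upwards [h2] with z hz
  simp [hz]

theorem add (hX : SmoothNear X x) (hY : SmoothNear Y x) : SmoothNear (fun y ↦ X y + Y y) x := by
  filter_upwards [hX, hY] with y h1 h2 using h1.add_section h2

theorem sub (hX : SmoothNear X x) (hY : SmoothNear Y x) : SmoothNear (fun y ↦ X y - Y y) x := by
  filter_upwards [hX, hY] with y h1 h2 using h1.sub_section h2

theorem smul (hf : SmoothFunNear (E := E) f x) (hX : SmoothNear X x) :
    SmoothNear (fun y ↦ f y • X y) x := by
  filter_upwards [hf, hX] with y h1 h2 using h1.smul_section h2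

theorem const_smul (c : ℝ) (hX : SmoothNear X x) : SmoothNear (fun y ↦ c • X y) x :=
  smul (SmoothFunNear.const c) hX

theorem sum {ι : Type*} {s : Finset ι} {X : ι → Π x : M, TangentSpace 𝓘(ℝ, E) x}
    (hX : ∀ i ∈ s, SmoothNear (X i) x) : SmoothNear (fun y ↦ ∑ i ∈ s, X i y) x := by
  have h : ∀ᶠ y in 𝓝 x, ∀ i ∈ s, CMDiffAt ∞ (T% (X i)) y :=
    (Filter.eventually_all_finset s).2 hX
  filter_upwards [h] with y h1
  exact ContMDiffAt.sum_section h1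

theorem inner (hX : SmoothNear X x) (hY : SmoothNear Y x) :
    SmoothFunNear (E := E) (fun y ↦ ⟪X y, Y y⟫) x := by
  filter_upwards [hX, hY] with y h1 h2
  exact ContMDiffAt.inner_bundle (F := E) (E := fun x : M ↦ TangentSpace 𝓘(ℝ, E) x) h1 h2

theorem extend (v : TangentSpace 𝓘(ℝ, E) x) : SmoothNear (extend E v) x := by
  obtain ⟨s, hs, h⟩ := exists_contMDiffOn_extend (k := ∞) 𝓘(ℝ, E) E v
  filter_upwards [eventually_eventually_nhds.2 hs] with y hy
  exact h.contMDiffAt hy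

theorem mlieBracket (hX : SmoothNear X x) (hY : SmoothNear Y x) :
    SmoothNear (mlieBracket 𝓘(ℝ, E) X Y) x := by
  have : CompleteSpace E := FiniteDimensional.complete ℝ E
  filter_upwards [hX, hY] with y h1 h2
  have : IsManifold 𝓘(ℝ, E) (((⊤ : ℕ∞) : ℕ∞ω) + 1) M := by simpa
  have : IsManifold 𝓘(ℝ, E) (minSmoothness ℝ 2) M := by
    rw [minSmoothness_of_isRCLikeNormedField]; infer_instance
  exact ContMDiffAt.mlieBracket_vectorField (m := ⊤) (n := ⊤) h1 h2 (by simp)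

/-- The derivative `X f` of a smooth function is smooth: it is read off from
`[X, f • Y] - f • [X, Y] = (X f) • Y` for a field `Y` which does not vanish at the point. -/
theorem mvfderiv (hX : SmoothNear X x) (hf : SmoothFunNear (E := E) f x) :
    SmoothFunNear (E := E) (fun y ↦ mvfderiv 𝓘(ℝ, E) f y (X y)) x := by
  by_cases h0 : Subsingleton E
  · -- no nonvanishing field exists when `M` has dimension zero
    have : ∀ y : M, Subsingleton (TangentSpace 𝓘(ℝ, E) y) := fun y ↦ h0
    refine (SmoothFunNear.const (0 : ℝ)).congr (.of_forall fun y ↦ ?_)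
    rw [Subsingleton.elim (X y) 0, map_zero]
  · obtain ⟨w, hw⟩ : ∃ w : TangentSpace 𝓘(ℝ, E) x, w ≠ 0 := by
      by_contra! h
      exact h0 ⟨fun a b ↦ (h a).trans (h b).symm⟩
    set W : Π x : M, TangentSpace 𝓘(ℝ, E) x := FiberBundle.extend E w with hWdef
    have hW : SmoothNear W x := extend w
    have hWx : ⟪W x, W x⟫ ≠ 0 := by simpa [hWdef] using hw
    have hd := ((hX.mlieBracket (smul hf hW)).sub (smul hf (hX.mlieBracket hW))).inner hW
    refine (hd.mul ((hW.inner hW).inv hWx)).congr ?_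
    filter_upwards [hf.eventually, hW.eventually,
      (hW.inner hW).mdiffAt.continuousAt.eventually_ne hWx] with y h1 h2 h3
    have := mlieBracket_smul_right (V := X) h1.mdiffAt h2.mdiffAt
    change VectorField.mlieBracket 𝓘(ℝ, E) X (fun y ↦ f y • W y) y = _ at this
    rw [this]
    simp only [add_sub_cancel_right, real_inner_smul_left]
    rw [mul_assoc, mul_inv_cancel₀ h3, mul_one]

end SmoothNear

/-- `[U, V] f = U (V f) - V (U f)`. This follows from the Jacobi identity for `U`, `V` and `f • W`
with `W` a field which does not vanish at the point. -/
theorem mvfderiv_mlieBracket {U V : Π x : M, TangentSpace 𝓘(ℝ, E) x} {f : M → ℝ} {x : M}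
    (hU : SmoothNear U x) (hV : SmoothNear V x) (hf : SmoothFunNear (E := E) f x) :
    mvfderiv 𝓘(ℝ, E) f x (mlieBracket 𝓘(ℝ, E) U V x) =
      mvfderiv 𝓘(ℝ, E) (fun y ↦ mvfderiv 𝓘(ℝ, E) f y (V y)) x (U x)
        - mvfderiv 𝓘(ℝ, E) (fun y ↦ mvfderiv 𝓘(ℝ, E) f y (U y)) x (V x) := by
  have : CompleteSpace E := FiniteDimensional.complete ℝ E
  by_cases h0 : ∀ w : TangentSpace 𝓘(ℝ, E) x, w = 0
  · rw [h0 (U x), h0 (V x), h0 (mlieBracket 𝓘(ℝ, E) U V x)]; simp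
  push Not at h0
  obtain ⟨w, hw⟩ := h0
  set W : Π x : M, TangentSpace 𝓘(ℝ, E) x := extend E w with hWdef
  have hW : SmoothNear W x := .extend w
  have hWx : W x ≠ 0 := by simpa [hWdef] using hw
  have h2 : ∀ {Z : Π x : M, TangentSpace 𝓘(ℝ, E) x}, SmoothNear Z x →
      CMDiffAt (minSmoothness ℝ 2) (T% Z) x := fun h ↦
    h.self_of_nhds.of_le (by
      rw [minSmoothness_of_isRCLikeNormedField]; exact ENat.LEInfty.out)
  have : IsManifold 𝓘(ℝ, E) (minSmoothness ℝ 3) M := by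
    rw [minSmoothness_of_isRCLikeNormedField]; infer_instance
  have hfW : SmoothNear (f • W) x := SmoothNear.smul hf hW
  have key : ∀ {A B : Π x : M, TangentSpace 𝓘(ℝ, E) x}, SmoothNear A x → SmoothNear B x →
      mlieBracket 𝓘(ℝ, E) A (mlieBracket 𝓘(ℝ, E) B (f • W)) x =
        mvfderiv 𝓘(ℝ, E) (fun y ↦ mvfderiv 𝓘(ℝ, E) f y (B y)) x (A x) • W x
        + mvfderiv 𝓘(ℝ, E) f x (B x) • mlieBracket 𝓘(ℝ, E) A W x
        + mvfderiv 𝓘(ℝ, E) f x (A x) • mlieBracket 𝓘(ℝ, E) B W x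
        + f x • mlieBracket 𝓘(ℝ, E) A (mlieBracket 𝓘(ℝ, E) B W) x := by
    intro A B hA hB
    have e : mlieBracket 𝓘(ℝ, E) B (f • W) =ᶠ[𝓝 x]
        ((fun y ↦ mvfderiv 𝓘(ℝ, E) f y (B y)) • W) + f • mlieBracket 𝓘(ℝ, E) B W := by
      filter_upwards [hf.eventually, hW.eventually] with y h1 h2
      rw [mlieBracket_smul_right h1.mdiffAt h2.mdiffAt]
      rfl
    have hBf := hB.mvfderiv hf
    have hBW := hB.mlieBracket hW
    rw [Filter.EventuallyEq.mlieBracket_vectorField_eq (Filter.EventuallyEq.refl _ A) e,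
      mlieBracket_add_right (W := (fun y ↦ mvfderiv 𝓘(ℝ, E) f y (B y)) • W)
        (W₁ := f • mlieBracket 𝓘(ℝ, E) B W)
        (SmoothNear.smul hBf hW).mdiffAt (SmoothNear.smul hf hBW).mdiffAt,
      mlieBracket_smul_right hBf.mdiffAt hW.mdiffAt,
      mlieBracket_smul_right hf.mdiffAt hBW.mdiffAt]
    module
  have jac := leibniz_identity_mlieBracket_apply (h2 hU) (h2 hV) (h2 hfW)
  have jac' := leibniz_identity_mlieBracket_apply (h2 hU) (h2 hV) (h2 hW)
  rw [key hU hV, key hV hU, mlieBracket_smul_right hf.mdiffAt hW.mdiffAt, jac'] at jac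
  have : (mvfderiv 𝓘(ℝ, E) f x (mlieBracket 𝓘(ℝ, E) U V x) -
      (mvfderiv 𝓘(ℝ, E) (fun y ↦ mvfderiv 𝓘(ℝ, E) f y (V y)) x (U x)
        - mvfderiv 𝓘(ℝ, E) (fun y ↦ mvfderiv 𝓘(ℝ, E) f y (U y)) x (V x))) • W x = 0 := by
    rw [← neg_eq_zero, ← sub_eq_zero.2 jac]
    module
  exact sub_eq_zero.1 ((smul_eq_zero.1 this).resolve_right hWx)

end SmoothFields

section Frames

/-! ### Smooth orthonormal frames -/

/-- The fields `e i` form, near `x`, a smooth orthonormal frame of the distribution `P`. -/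
structure IsOrthonormalFrameNear {ι : Type*} (P : Π x : M, Submodule ℝ (TangentSpace 𝓘(ℝ, E) x))
    (e : ι → Π x : M, TangentSpace 𝓘(ℝ, E) x) (x : M) : Prop where
  smooth : ∀ i, SmoothNear (e i) x
  orthonormal : ∀ᶠ y in 𝓝 x, Orthonormal ℝ fun i ↦ e i y
  span_eq : ∀ᶠ y in 𝓝 x, Submodule.span ℝ (Set.range fun i ↦ e i y) = P y

theorem smoothNear_gramSchmidt {k : ℕ} {s : Fin k → Π x : M, TangentSpace 𝓘(ℝ, E) x} {x : M}
    (hs : ∀ i, SmoothNear (s i) x) (hli : ∀ᶠ y in 𝓝 x, LinearIndependent ℝ fun i ↦ s i y)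
    (i : Fin k) :
    SmoothNear (fun y ↦ InnerProductSpace.gramSchmidt ℝ (fun j ↦ s j y) i) x := by
  induction i using WellFoundedLT.induction with
  | ind i ih =>
    have h : SmoothNear (fun y ↦ s i y - ∑ j ∈ Finset.Iio i,
        (⟪InnerProductSpace.gramSchmidt ℝ (fun j ↦ s j y) j, s i y⟫ *
          (⟪InnerProductSpace.gramSchmidt ℝ (fun j ↦ s j y) j,
            InnerProductSpace.gramSchmidt ℝ (fun j ↦ s j y) j⟫)⁻¹) •
          InnerProductSpace.gramSchmidt ℝ (fun j ↦ s j y) j) x := by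
      refine (hs i).sub (.sum fun j hj ↦ ?_)
      have hj' := ih j (Finset.mem_Iio.1 hj)
      refine .smul ((hj'.inner (hs i)).mul ((hj'.inner hj').inv ?_)) hj'
      rw [inner_self_ne_zero]
      exact InnerProductSpace.gramSchmidt_ne_zero j hli.self_of_nhds
    refine h.congr (.of_forall fun y ↦ ?_)
    rw [eq_sub_iff_add_eq]
    conv_rhs => rw [InnerProductSpace.gramSchmidt_def'' ℝ (fun j ↦ s j y) i]
    simp [div_eq_mul_inv]

theorem IsSmoothDistribution.exists_frame {k : ℕ}
    {P : Π x : M, Submodule ℝ (TangentSpace 𝓘(ℝ, E) x)} (hP : IsSmoothDistribution k P) (x : M) :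
    ∃ e : Fin k → Π x : M, TangentSpace 𝓘(ℝ, E) x, IsOrthonormalFrameNear P e x := by
  obtain ⟨U, s, hU, hxU, hs, h⟩ := hP x
  have hUx := hU.mem_nhds hxU
  have hsm : ∀ i, SmoothNear (s i) x := fun i ↦ by
    filter_upwards [hUx] with y hy using (hs i).contMDiffAt (hU.mem_nhds hy)
  have hli : ∀ᶠ y in 𝓝 x, LinearIndependent ℝ fun i ↦ s i y := by
    filter_upwards [hUx] with y hy using (h y hy).1
  refine ⟨fun i y ↦ InnerProductSpace.gramSchmidtNormed ℝ (fun j ↦ s j y) i, fun i ↦ ?_, ?_, ?_⟩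
  · have hg := smoothNear_gramSchmidt hsm hli i
    have h0 := InnerProductSpace.gramSchmidt_ne_zero i hli.self_of_nhds
    refine (SmoothNear.smul (((hg.inner hg).sqrt ?_).inv ?_) hg).congr (.of_forall fun y ↦ ?_)
    · rwa [inner_self_ne_zero]
    · rw [← norm_eq_sqrt_real_inner]
      exact norm_ne_zero_iff.2 h0
    · rw [← norm_eq_sqrt_real_inner]
      simp [InnerProductSpace.gramSchmidtNormed]
  · filter_upwards [hli] with y hy using InnerProductSpace.gramSchmidtNormed_orthonormal hy
  · filter_upwards [hUx] with y hy
    rw [InnerProductSpace.span_gramSchmidtNormed_range, InnerProductSpace.span_gramSchmidt,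
      (h y hy).2]

theorem isSmoothDistribution_top :
    IsSmoothDistribution (finrank ℝ E)
      (fun x : M ↦ (⊤ : Submodule ℝ (TangentSpace 𝓘(ℝ, E) x))) := by
  intro x
  let t := trivializationAt E (TangentSpace 𝓘(ℝ, E) : M → Type _) x
  let b := Module.finBasis ℝ E
  have hf := t.isLocalFrameOn_localFrame_baseSet 𝓘(ℝ, E) ∞ b
  refine ⟨t.baseSet, t.localFrame b, t.open_baseSet, mem_baseSet_trivializationAt' x,
    fun i ↦ hf.contMDiffOn i, fun y hy ↦ ⟨hf.linearIndependent hy, ?_⟩⟩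
  exact top_le_iff.1 (hf.generating hy)

theorem _root_.Orthonormal.starProjection_eq_sum {V ι : Type*} [NormedAddCommGroup V]
    [InnerProductSpace ℝ V] [Fintype ι] {K : Submodule ℝ V} [K.HasOrthogonalProjection]
    {e : ι → V} (he : Orthonormal ℝ e) (hK : Submodule.span ℝ (Set.range e) = K) (v : V) :
    K.starProjection v = ∑ i, ⟪e i, v⟫ • e i := by
  symm
  refine (Submodule.eq_starProjection_of_mem_of_inner_eq_zero ?_ fun w hw ↦ ?_).symm
  · rw [← hK]
    exact Submodule.sum_mem _ fun i _ ↦ Submodule.smul_mem _ _ (Submodule.subset_span ⟨i, rfl⟩)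
  · rw [← hK] at hw
    induction hw using Submodule.span_induction with
    | mem w hw =>
      obtain ⟨i, rfl⟩ := hw
      classical
      simp [inner_sub_left, sum_inner, inner_smul_left, orthonormal_iff_ite.1 he, real_inner_comm]
    | zero => simp
    | add a b _ _ ha hb => rw [inner_add_right, ha, hb, add_zero]
    | smul c a _ ha => rw [inner_smul_right, ha, mul_zero]

variable {P Q : Π x : M, Submodule ℝ (TangentSpace 𝓘(ℝ, E) x)} {x : M}

namespace IsOrthonormalFrameNear

variable {ι : Type*} [Fintype ι] {e : ι → Π x : M, TangentSpace 𝓘(ℝ, E) x}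

theorem eventually (he : IsOrthonormalFrameNear P e x) :
    ∀ᶠ y in 𝓝 x, IsOrthonormalFrameNear P e y := by
  filter_upwards [Filter.eventually_all.2 fun i ↦ (he.smooth i).eventually,
    eventually_eventually_nhds.2 he.orthonormal, eventually_eventually_nhds.2 he.span_eq]
    with y h1 h2 h3 using ⟨h1, h2, h3⟩

theorem mem (he : IsOrthonormalFrameNear P e x) : ∀ᶠ y in 𝓝 x, ∀ i, e i y ∈ P y := by
  filter_upwards [he.span_eq] with y hy i
  rw [← hy]
  exact Submodule.subset_span ⟨i, rfl⟩

theorem proj_eq_sum (he : IsOrthonormalFrameNear P e x) (v : TangentSpace 𝓘(ℝ, E) x) :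
    proj P x v = ∑ i, ⟪e i x, v⟫ • e i x :=
  Orthonormal.starProjection_eq_sum he.orthonormal.self_of_nhds he.span_eq.self_of_nhds v

theorem smoothNear_proj (he : IsOrthonormalFrameNear P e x)
    {X : Π x : M, TangentSpace 𝓘(ℝ, E) x} (hX : SmoothNear X x) :
    SmoothNear (fun y ↦ proj P y (X y)) x := by
  have h : SmoothNear (fun y ↦ ∑ i, ⟪e i y, X y⟫ • e i y) x :=
    .sum fun i _ ↦ .smul ((he.smooth i).inner hX) (he.smooth i)
  refine h.congr ?_
  filter_upwards [he.eventually] with y hy using hy.proj_eq_sum _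

end IsOrthonormalFrameNear

theorem IsSmoothDistribution.smoothNear_proj {k : ℕ} (hP : IsSmoothDistribution k P)
    {X : Π x : M, TangentSpace 𝓘(ℝ, E) x} (hX : SmoothNear X x) :
    SmoothNear (fun y ↦ proj P y (X y)) x :=
  (hP.exists_frame x).choose_spec.smoothNear_proj hX

theorem IsSmoothDistribution.mdiffAt_proj {k : ℕ} (hP : IsSmoothDistribution k P)
    {X : Π x : M, TangentSpace 𝓘(ℝ, E) x} (hX : MDiffAt (T% X) x) :
    MDiffAt (T% (fun y ↦ proj P y (X y))) x := by
  obtain ⟨e, he⟩ := hP.exists_frame x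
  have h : MDiffAt (T% (fun y ↦ ∑ i, ⟪e i y, X y⟫ • e i y)) x :=
    .sum_section fun i _ ↦
      (mdifferentiableAt_inner (he.smooth i).mdiffAt hX).smul_section (he.smooth i).mdiffAt
  refine h.congr_of_eventuallyEq ?_
  filter_upwards [he.eventually] with y hy
  rw [hy.proj_eq_sum]

/-! ### The Levi-Civita connection on smooth fields -/

section LeviCivita

variable {X Y Z : Π x : M, TangentSpace 𝓘(ℝ, E) x} {f : M → ℝ}

theorem leviCivita_congr (hX : MDiffAt (T% X) x) (h : ∀ᶠ y in 𝓝 x, Y y = X y) :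
    leviCivita Y x = leviCivita X x := by
  have hY : MDiffAt (T% Y) x := by
    refine hX.congr_of_eventuallyEq ?_
    filter_upwards [h] with y hy
    rw [hy]
  exact leviCivita.isCovariantDerivativeOnUniv.congr_of_eventuallyEq hY hX Filter.univ_mem h

theorem leviCivita_add (hX : MDiffAt (T% X) x) (hY : MDiffAt (T% Y) x) :
    leviCivita (fun y ↦ X y + Y y) x = leviCivita X x + leviCivita Y x :=
  leviCivita.isCovariantDerivativeOnUniv.add hX hY

theorem leviCivita_smul (hf : MDiffAt f x) (hX : MDiffAt (T% X) x) :
    leviCivita (fun y ↦ f y • X y) x =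
      f x • leviCivita X x + (mvfderiv 𝓘(ℝ, E) f x).smulRight (X x) :=
  leviCivita.isCovariantDerivativeOnUniv.leibniz hX hf

theorem leviCivita_const_smul (c : ℝ) (hX : MDiffAt (T% X) x) :
    leviCivita (fun y ↦ c • X y) x = c • leviCivita X x :=
  leviCivita.isCovariantDerivativeOnUniv.smul_const c hX

theorem leviCivita_sub (hX : MDiffAt (T% X) x) (hY : MDiffAt (T% Y) x) :
    leviCivita (fun y ↦ X y - Y y) x = leviCivita X x - leviCivita Y x := by
  have h := leviCivita_add hX (Y := fun y ↦ (-1 : ℝ) • Y y)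
    (mdifferentiableAt_const.smul_section hY)
  rw [leviCivita_const_smul _ hY] at h
  simpa [sub_eq_add_neg] using h

theorem leviCivita_sum {ι : Type*} {s : Finset ι} {X : ι → Π x : M, TangentSpace 𝓘(ℝ, E) x}
    (hX : ∀ i ∈ s, MDiffAt (T% (X i)) x) :
    leviCivita (fun y ↦ ∑ i ∈ s, X i y) x = ∑ i ∈ s, leviCivita (X i) x := by
  classical
  induction s using Finset.induction_on with
  | empty =>
    have := congrFun (leviCivita (E := E) (M := M)).zero x
    exact this
  | insert a s ha ih =>
    simp only [Finset.mem_insert, forall_eq_or_imp] at hX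
    simp only [Finset.sum_insert ha, ← ih hX.2]
    exact leviCivita_add hX.1 (.sum_section hX.2)

/-- Torsion-freeness, for fields. -/
theorem leviCivita_sub_swap (hX : MDiffAt (T% X) x) (hY : MDiffAt (T% Y) x) :
    mlieBracket 𝓘(ℝ, E) X Y x = leviCivita Y x (X x) - leviCivita X x (Y x) :=
  (((leviCivita (E := E) (M := M)).torsion_eq_zero_iff.1 leviCivita_torsion) hX hY).symm

/-- Metric compatibility, for the derivative in the direction of a vector. -/
theorem leviCivita_inner (hY : MDiffAt (T% Y) x) (hZ : MDiffAt (T% Z) x)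
    (v : TangentSpace 𝓘(ℝ, E) x) :
    mvfderiv 𝓘(ℝ, E) (fun y ↦ ⟪Y y, Z y⟫) x v
      = ⟪leviCivita Y x v, Z x⟫ + ⟪Y x, leviCivita Z x v⟫ := by
  simpa using leviCivita_metric (X := extend E v) (mdifferentiableAt_extend ..) hY hZ

theorem mvfderiv_congr {g : M → ℝ} (h : ∀ᶠ y in 𝓝 x, f y = g y) :
    mvfderiv 𝓘(ℝ, E) f x = mvfderiv 𝓘(ℝ, E) g x := by
  have h' : f =ᶠ[𝓝 x] g := h
  ext v
  simp only [mvfderiv, h'.mfderiv_eq]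
  rfl

/-- If `⟪Y, Z⟫` vanishes near `x`, then `⟪∇_v Y, Z⟫ = -⟪Y, ∇_v Z⟫` at `x`. -/
theorem inner_leviCivita_of_orthogonal (hY : MDiffAt (T% Y) x) (hZ : MDiffAt (T% Z) x)
    (h : ∀ᶠ y in 𝓝 x, ⟪Y y, Z y⟫ = 0) (v : TangentSpace 𝓘(ℝ, E) x) :
    ⟪leviCivita Y x v, Z x⟫ = -⟪Y x, leviCivita Z x v⟫ := by
  have := leviCivita_inner hY hZ v
  rw [mvfderiv_congr (g := fun _ ↦ (0 : ℝ)) h, mvfderiv_const] at this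
  simp only [_root_.zero_apply] at this
  linarith

theorem SmoothNear.koszul (hX : SmoothNear X x) (hY : SmoothNear Y x) (hZ : SmoothNear Z x) :
    SmoothFunNear (E := E) (koszul X Y Z) x :=
  (((((hX.mvfderiv (hY.inner hZ)).add (hY.mvfderiv (hZ.inner hX))).sub
    (hZ.mvfderiv (hX.inner hY))).add ((hX.mlieBracket hY).inner hZ)).sub
    ((hY.mlieBracket hZ).inner hX)).add ((hZ.mlieBracket hX).inner hY)

/-- The Levi-Civita connection is smooth: in an orthonormal frame the components of `∇_X Y` are
given by the Koszul formula. -/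
theorem SmoothNear.leviCivita (hX : SmoothNear X x) (hY : SmoothNear Y x) :
    SmoothNear (fun y ↦ leviCivita Y y (X y)) x := by
  obtain ⟨e, he⟩ := (isSmoothDistribution_top (E := E) (M := M)).exists_frame x
  have h : SmoothNear (fun y ↦ ∑ i, (1 / 2 * AlmostProduct.koszul X Y (e i) y) • e i y) x :=
    .sum fun i _ ↦ .smul ((SmoothFunNear.const _).mul (hX.koszul hY (he.smooth i))) (he.smooth i)
  refine h.congr ?_
  filter_upwards [he.eventually, hX.eventually, hY.eventually] with y h1 h2 h3
  have := h1.proj_eq_sum (AlmostProduct.leviCivita Y y (X y))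
  rw [proj, Submodule.starProjection_top, ContinuousLinearMap.id_apply] at this
  rw [this]
  refine Finset.sum_congr rfl fun i _ ↦ ?_
  rw [real_inner_comm]
  congr 1
  exact inner_lcFun_field h2.mdiffAt h3.mdiffAt (h1.smooth i).mdiffAt

end LeviCivita

end Frames

section Curvature

/-! ### Symmetries of the curvature tensor -/

variable {X Y Z W X' Y' Z' : Π x : M, TangentSpace 𝓘(ℝ, E) x} {x : M}

/-- The second covariant derivative `∇²_{v, X} Z = ∇_v ∇_X Z - ∇_{∇_v X} Z`. -/
def secondCov (Z X : Π x : M, TangentSpace 𝓘(ℝ, E) x) (x : M) (v : TangentSpace 𝓘(ℝ, E) x) :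
    TangentSpace 𝓘(ℝ, E) x :=
  leviCivita (fun y ↦ leviCivita Z y (X y)) x v - leviCivita Z x (leviCivita X x v)

theorem secondCov_eq_sum {ι : Type*} [Fintype ι] {e : ι → Π x : M, TangentSpace 𝓘(ℝ, E) x}
    (he : IsOrthonormalFrameNear (fun _ ↦ ⊤) e x) (hZ : SmoothNear Z x) (hX : SmoothNear X x)
    (v : TangentSpace 𝓘(ℝ, E) x) :
    secondCov Z X x v = ∑ i, ⟪e i x, X x⟫ • secondCov Z (e i) x v := by
  have hf : ∀ i, SmoothFunNear (E := E) (fun y ↦ ⟪e i y, X y⟫) x :=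
    fun i ↦ (he.smooth i).inner hX
  have hXe : ∀ᶠ y in 𝓝 x, X y = ∑ i, ⟪e i y, X y⟫ • e i y := by
    filter_upwards [he.eventually] with y hy
    have := hy.proj_eq_sum (X y)
    rwa [proj, Submodule.starProjection_top, ContinuousLinearMap.id_apply] at this
  have hZe : ∀ᶠ y in 𝓝 x, leviCivita Z y (X y) = ∑ i, ⟪e i y, X y⟫ • leviCivita Z y (e i y) := by
    filter_upwards [hXe] with y hy
    conv_lhs => rw [hy]
    simp
  have h1 : ∀ i, SmoothNear (fun y ↦ ⟪e i y, X y⟫ • leviCivita Z y (e i y)) x :=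
    fun i ↦ .smul (hf i) ((he.smooth i).leviCivita hZ)
  have h2 : ∀ i, SmoothNear (fun y ↦ ⟪e i y, X y⟫ • e i y) x :=
    fun i ↦ .smul (hf i) (he.smooth i)
  rw [secondCov, leviCivita_congr (SmoothNear.sum fun i _ ↦ h1 i).mdiffAt hZe,
    leviCivita_congr (SmoothNear.sum fun i _ ↦ h2 i).mdiffAt hXe,
    leviCivita_sum fun i _ ↦ (h1 i).mdiffAt, leviCivita_sum fun i _ ↦ (h2 i).mdiffAt]
  simp only [_root_.sum_apply, map_sum]
  rw [← Finset.sum_sub_distrib]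
  refine Finset.sum_congr rfl fun i _ ↦ ?_
  rw [leviCivita_smul (hf i).mdiffAt (he.smooth i).mdiffAt,
    leviCivita_smul (hf i).mdiffAt ((he.smooth i).leviCivita hZ).mdiffAt]
  simp only [secondCov, _root_.add_apply, _root_.smul_apply, ContinuousLinearMap.smulRight_apply,
    map_add, map_smul]
  module

theorem secondCov_congr (hZ : SmoothNear Z x) (hX : SmoothNear X x) (hX' : SmoothNear X' x)
    (h : X x = X' x) (v : TangentSpace 𝓘(ℝ, E) x) : secondCov Z X x v = secondCov Z X' x v := by
  obtain ⟨e, he⟩ := (isSmoothDistribution_top (E := E) (M := M)).exists_frame x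
  rw [secondCov_eq_sum he hZ hX, secondCov_eq_sum he hZ hX', h]

theorem curvatureField_eq_secondCov (hX : SmoothNear X x) (hY : SmoothNear Y x) :
    curvatureField X Y Z x = secondCov Z X x (Y x) - secondCov Z Y x (X x) := by
  rw [curvatureField, secondCov, secondCov, leviCivita_sub_swap hX.mdiffAt hY.mdiffAt, map_sub]
  abel

theorem mvfderiv_mvfderiv_inner (hX : SmoothNear X x) (hZ : SmoothNear Z x) (hW : SmoothNear W x)
    (v : TangentSpace 𝓘(ℝ, E) x) :
    mvfderiv 𝓘(ℝ, E) (fun y ↦ mvfderiv 𝓘(ℝ, E) (fun z ↦ ⟪Z z, W z⟫) y (X y)) x v =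
      ⟪leviCivita (fun y ↦ leviCivita Z y (X y)) x v, W x⟫
        + ⟪leviCivita Z x (X x), leviCivita W x v⟫ + ⟪leviCivita Z x v, leviCivita W x (X x)⟫
        + ⟪Z x, leviCivita (fun y ↦ leviCivita W y (X y)) x v⟫ := by
  have hXZ := hX.leviCivita hZ
  have hXW := hX.leviCivita hW
  have h : ∀ᶠ y in 𝓝 x, mvfderiv 𝓘(ℝ, E) (fun z ↦ ⟪Z z, W z⟫) y (X y) =
      ⟪leviCivita Z y (X y), W y⟫ + ⟪Z y, leviCivita W y (X y)⟫ := by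
    filter_upwards [hZ.eventually, hW.eventually] with y h1 h2
      using leviCivita_inner h1.mdiffAt h2.mdiffAt _
  rw [mvfderiv_congr h, mvfderiv_fun_add (hXZ.inner hW).mdiffAt (hZ.inner hXW).mdiffAt,
    _root_.add_apply, leviCivita_inner hXZ.mdiffAt hW.mdiffAt,
    leviCivita_inner hZ.mdiffAt hXW.mdiffAt]
  ring

theorem inner_curvatureField_skew (hX : SmoothNear X x) (hY : SmoothNear Y x)
    (hZ : SmoothNear Z x) (hW : SmoothNear W x) :
    ⟪curvatureField X Y Z x, W x⟫ = -⟪Z x, curvatureField X Y W x⟫ := by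
  have h := mvfderiv_mlieBracket hX hY (hZ.inner hW)
  rw [mvfderiv_mvfderiv_inner hX hZ hW, mvfderiv_mvfderiv_inner hY hZ hW,
    leviCivita_inner hZ.mdiffAt hW.mdiffAt] at h
  simp only [curvatureField, inner_add_left, inner_sub_left, inner_add_right, inner_sub_right]
  linarith

/-- The curvature of smooth fields at `x` depends only on the values of the fields at `x`. In the
first two arguments it is a difference of second covariant derivatives, in the third one
tensoriality is inherited from the skew-symmetry of `R(X, Y)`. -/
theorem curvatureField_congr (hX : SmoothNear X x) (hX' : SmoothNear X' x) (hXX : X x = X' x)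
    (hY : SmoothNear Y x) (hY' : SmoothNear Y' x) (hYY : Y x = Y' x)
    (hZ : SmoothNear Z x) (hZ' : SmoothNear Z' x) (hZZ : Z x = Z' x) :
    curvatureField X Y Z x = curvatureField X' Y' Z' x := by
  trans curvatureField X Y Z' x
  · refine ext_inner_right ℝ fun w ↦ ?_
    have hw := SmoothNear.extend w
    have h1 := inner_curvatureField_skew hX hY hZ hw
    have h2 := inner_curvatureField_skew hX hY hZ' hw
    rw [extend_apply_self] at h1 h2
    rw [h1, h2, hZZ]
  · rw [curvatureField_eq_secondCov hX hY, curvatureField_eq_secondCov hX' hY',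
      secondCov_congr hZ' hX hX' hXX, secondCov_congr hZ' hY hY' hYY, hXX, hYY]

theorem curvature_apply (hX : SmoothNear X x) (hY : SmoothNear Y x) (hZ : SmoothNear Z x) :
    curvature x (X x) (Y x) (Z x) = curvatureField X Y Z x :=
  curvatureField_congr (.extend _) hX (by simp) (.extend _) hY (by simp) (.extend _) hZ (by simp)

/-- The first Bianchi identity. -/
theorem curvatureField_bianchi (hX : SmoothNear X x) (hY : SmoothNear Y x) (hZ : SmoothNear Z x) :
    curvatureField X Y Z x + curvatureField Y Z X x + curvatureField Z X Y x = 0 := by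
  have : CompleteSpace E := FiniteDimensional.complete ℝ E
  have h2 : ∀ {Z : Π x : M, TangentSpace 𝓘(ℝ, E) x}, SmoothNear Z x →
      CMDiffAt (minSmoothness ℝ 2) (T% Z) x := fun h ↦
    h.self_of_nhds.of_le (by
      rw [minSmoothness_of_isRCLikeNormedField]; exact ENat.LEInfty.out)
  have : IsManifold 𝓘(ℝ, E) (minSmoothness ℝ 3) M := by
    rw [minSmoothness_of_isRCLikeNormedField]; infer_instance
  have jac := leibniz_identity_mlieBracket_apply (h2 hX) (h2 hY) (h2 hZ)
  have key : ∀ {A B C : Π x : M, TangentSpace 𝓘(ℝ, E) x}, SmoothNear A x → SmoothNear B x →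
      SmoothNear C x → mlieBracket 𝓘(ℝ, E) A (mlieBracket 𝓘(ℝ, E) B C) x =
        leviCivita (fun y ↦ leviCivita C y (B y)) x (A x)
        - leviCivita (fun y ↦ leviCivita B y (C y)) x (A x)
        - leviCivita A x (mlieBracket 𝓘(ℝ, E) B C x) := by
    intro A B C hA hB hC
    have e : ∀ᶠ y in 𝓝 x, mlieBracket 𝓘(ℝ, E) B C y =
        leviCivita C y (B y) - leviCivita B y (C y) := by
      filter_upwards [hB.eventually, hC.eventually] with y h1 h2
        using leviCivita_sub_swap h1.mdiffAt h2.mdiffAt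
    rw [leviCivita_sub_swap hA.mdiffAt (hB.mlieBracket hC).mdiffAt,
      leviCivita_congr ((hB.leviCivita hC).sub (hC.leviCivita hB)).mdiffAt e,
      leviCivita_sub (hB.leviCivita hC).mdiffAt (hC.leviCivita hB).mdiffAt]
    rfl
  rw [mlieBracket_swap_apply (V := mlieBracket 𝓘(ℝ, E) X Y), key hX hY hZ, key hZ hX hY,
    key hY hX hZ] at jac
  simp only [curvatureField]
  rw [mlieBracket_swap_apply (V := Z) (W := X), map_neg, ← neg_eq_zero,
    ← sub_eq_zero.2 jac]
  abel

/-- The symmetry `⟪R(u, v) u, w⟫ = ⟪R(u, w) u, v⟫`. -/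
theorem inner_curvature_symm (x : M) (u v w : TangentSpace 𝓘(ℝ, E) x) :
    ⟪curvature x u v u, w⟫ = ⟪curvature x u w u, v⟫ := by
  have hu := SmoothNear.extend u
  have hv := SmoothNear.extend v
  have hw := SmoothNear.extend w
  have hb := congrArg (fun a ↦ ⟪a, u⟫) (curvatureField_bianchi hu hv hw)
  have h1 := inner_curvatureField_skew hu hv hw hu
  have h2 := inner_curvatureField_skew hv hw hu hu
  have h3 := inner_curvatureField_skew hu hw hv hu
  have h4 : curvatureField (extend E w) (extend E u) (extend E v) x =
      -curvatureField (extend E u) (extend E w) (extend E v) x := by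
    rw [curvatureField_eq_secondCov hw hu, curvatureField_eq_secondCov hu hw]
    abel
  rw [h4] at hb
  simp only [extend_apply_self, inner_add_left, inner_neg_left, inner_zero_left] at hb h1 h2 h3
  have h5 := real_inner_comm u (curvatureField (extend E v) (extend E w) (extend E u) x)
  simp only [curvature]
  rw [real_inner_comm v, real_inner_comm w]
  linarith

end Curvature

section SecondFundamentalTensor

/-! ### Pairs of orthogonal complementary distributions -/

variable {n p : ℕ} {P Q : Π x : M, Submodule ℝ (TangentSpace 𝓘(ℝ, E) x)} {x : M}

theorem IsAdaptedPair.symm (h : IsAdaptedPair n p P Q) : IsAdaptedPair p n Q P where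
  smooth_left := h.smooth_right
  smooth_right := h.smooth_left
  isCompl x := (h.isCompl x).symm
  adapted x v hv w hw := by rw [real_inner_comm]; exact h.adapted x w hw v hv

theorem proj_mem (P : Π x : M, Submodule ℝ (TangentSpace 𝓘(ℝ, E) x)) (x : M)
    (v : TangentSpace 𝓘(ℝ, E) x) : proj P x v ∈ P x :=
  Submodule.starProjection_apply_mem _ _

theorem proj_of_mem {v : TangentSpace 𝓘(ℝ, E) x} (hv : v ∈ P x) : proj P x v = v :=
  Submodule.starProjection_eq_self_iff.2 hv

theorem proj_proj (v : TangentSpace 𝓘(ℝ, E) x) : proj P x (proj P x v) = proj P x v :=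
  proj_of_mem (proj_mem P x v)

theorem inner_proj_comm (v w : TangentSpace 𝓘(ℝ, E) x) : ⟪proj P x v, w⟫ = ⟪v, proj P x w⟫ :=
  (P x).starProjection_isSymmetric v w

namespace IsAdaptedPair

theorem proj_right_eq_zero (h : IsAdaptedPair n p P Q) {v : TangentSpace 𝓘(ℝ, E) x}
    (hv : v ∈ P x) : proj Q x v = 0 := by
  refine ext_inner_right ℝ fun w ↦ ?_
  rw [inner_proj_comm, h.adapted x v hv _ (proj_mem Q x w), inner_zero_left]

theorem proj_add_proj (h : IsAdaptedPair n p P Q) (v : TangentSpace 𝓘(ℝ, E) x) :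
    proj P x v + proj Q x v = v := by
  obtain ⟨a, ha, b, hb, rfl⟩ : ∃ a ∈ P x, ∃ b ∈ Q x, a + b = v :=
    Submodule.mem_sup.1 ((h.isCompl x).sup_eq_top ▸ Submodule.mem_top)
  rw [map_add, map_add, proj_of_mem ha, proj_of_mem hb, h.proj_right_eq_zero ha,
    h.symm.proj_right_eq_zero hb, add_zero, zero_add]

end IsAdaptedPair

theorem smoothNear_extendIn (hP : IsSmoothDistribution n P) (v : TangentSpace 𝓘(ℝ, E) x) :
    SmoothNear (extendIn P v) x :=
  hP.smoothNear_proj (.extend v)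

theorem extendIn_self (v : TangentSpace 𝓘(ℝ, E) x) : extendIn P v x = proj P x v := by
  simp [extendIn]

theorem extendIn_mem (v : TangentSpace 𝓘(ℝ, E) x) (y : M) : extendIn P v y ∈ P y :=
  proj_mem P y _

/-! ### The second fundamental tensor -/

/-- The tensor `(∇_X Y)^Q` for fields `X, Y` in `P`, extended to all tangent vectors by projecting
the arguments to `P`. Its symmetric and antisymmetric parts are the second fundamental form and
the integrability tensor of `P`. -/
def secondFund (P Q : Π x : M, Submodule ℝ (TangentSpace 𝓘(ℝ, E) x)) (x : M)
    (u v : TangentSpace 𝓘(ℝ, E) x) : TangentSpace 𝓘(ℝ, E) x :=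
  proj Q x (leviCivita (extendIn P v) x (proj P x u))

theorem secondFund_mem (u v : TangentSpace 𝓘(ℝ, E) x) : secondFund P Q x u v ∈ Q x :=
  proj_mem Q x _

theorem secondFund_proj_left (u v : TangentSpace 𝓘(ℝ, E) x) :
    secondFund P Q x (proj P x u) v = secondFund P Q x u v := by
  simp [secondFund, proj_proj]

theorem secondForm_eq (u v : TangentSpace 𝓘(ℝ, E) x) :
    secondForm P Q x u v = (1 / 2 : ℝ) • (secondFund P Q x u v + secondFund P Q x v u) := by
  rw [secondForm, map_add]
  rfl

theorem integrability_eq (hP : IsSmoothDistribution n P) (u v : TangentSpace 𝓘(ℝ, E) x) :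
    integrability P Q x u v = (1 / 2 : ℝ) • (secondFund P Q x u v - secondFund P Q x v u) := by
  rw [integrability, leviCivita_sub_swap (smoothNear_extendIn hP u).mdiffAt
    (smoothNear_extendIn hP v).mdiffAt, map_sub, extendIn_self, extendIn_self]
  rfl

namespace IsAdaptedPair

variable {X Y : Π x : M, TangentSpace 𝓘(ℝ, E) x}

/-- For a direction `w` in `P`, the `Q`-component of `∇_w (X^P)` depends only on the value of `X` at
the point. -/
theorem proj_leviCivita_proj (h : IsAdaptedPair n p P Q) (hX : MDiffAt (T% X) x)
    (w : TangentSpace 𝓘(ℝ, E) x) :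
    proj Q x (leviCivita (fun y ↦ proj P y (X y)) x (proj P x w)) = secondFund P Q x w (X x) := by
  have ht : TensorialAt 𝓘(ℝ, E) E (fun X : Π x : M, TangentSpace 𝓘(ℝ, E) x ↦
      proj Q x (leviCivita (fun y ↦ proj P y (X y)) x (proj P x w))) x :=
    { smul := by
        intro f σ hf hσ
        have hσ' := h.smooth_left.mdiffAt_proj hσ
        simp only [Pi.smul_apply', map_smul]
        rw [leviCivita_smul hf hσ']
        simp [h.proj_right_eq_zero (proj_mem P x _)]
      add := by
        intro σ σ' hσ hσ'
        simp only [Pi.add_apply, map_add]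
        rw [leviCivita_add (h.smooth_left.mdiffAt_proj hσ) (h.smooth_left.mdiffAt_proj hσ')]
        simp }
  exact ht.pointwise hX (mdifferentiableAt_extend ..) (by simp)

theorem proj_leviCivita (h : IsAdaptedPair n p P Q) (hX : MDiffAt (T% X) x)
    (hXP : ∀ᶠ y in 𝓝 x, X y ∈ P y) {w : TangentSpace 𝓘(ℝ, E) x} (hw : w ∈ P x) :
    proj Q x (leviCivita X x w) = secondFund P Q x w (X x) := by
  rw [← h.proj_leviCivita_proj hX, proj_of_mem hw,
    leviCivita_congr (Y := fun y ↦ proj P y (X y)) hX]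
  filter_upwards [hXP] with y hy using proj_of_mem hy

theorem secondFund_add_right (h : IsAdaptedPair n p P Q) (u v w : TangentSpace 𝓘(ℝ, E) x) :
    secondFund P Q x u (v + w) = secondFund P Q x u v + secondFund P Q x u w := by
  have hv := (SmoothNear.extend v).mdiffAt
  have hw := (SmoothNear.extend w).mdiffAt
  have h1 := h.proj_leviCivita_proj
    (((SmoothNear.extend v).add (SmoothNear.extend w)).mdiffAt) u
  simp only [map_add, extend_apply_self] at h1
  rw [← h1, leviCivita_add (h.smooth_left.mdiffAt_proj hv) (h.smooth_left.mdiffAt_proj hw),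
    _root_.add_apply, map_add]
  rfl

theorem secondFund_smul_right (h : IsAdaptedPair n p P Q) (c : ℝ)
    (u v : TangentSpace 𝓘(ℝ, E) x) :
    secondFund P Q x u (c • v) = c • secondFund P Q x u v := by
  have hv := (SmoothNear.extend v).mdiffAt
  have h1 := h.proj_leviCivita_proj ((SmoothNear.extend v).const_smul c).mdiffAt u
  simp only [map_smul, extend_apply_self] at h1
  rw [← h1, leviCivita_const_smul _ (h.smooth_left.mdiffAt_proj hv), _root_.smul_apply, map_smul]
  rfl

/-- The second fundamental tensor as a bilinear map. -/
def secondFundBilin (h : IsAdaptedPair n p P Q) (x : M) :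
    TangentSpace 𝓘(ℝ, E) x →ₗ[ℝ] TangentSpace 𝓘(ℝ, E) x →ₗ[ℝ] TangentSpace 𝓘(ℝ, E) x :=
  LinearMap.mk₂ ℝ (secondFund P Q x) (fun u v w ↦ by simp [secondFund])
    (fun c u v ↦ by simp [secondFund]) h.secondFund_add_right
    (fun c u v ↦ h.secondFund_smul_right c u v)

theorem secondFundBilin_apply (h : IsAdaptedPair n p P Q) (u v : TangentSpace 𝓘(ℝ, E) x) :
    h.secondFundBilin x u v = secondFund P Q x u v := rfl

theorem secondFund_proj_right (h : IsAdaptedPair n p P Q) (u v : TangentSpace 𝓘(ℝ, E) x) :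
    secondFund P Q x u (proj P x v) = secondFund P Q x u v := by
  have h1 := h.proj_leviCivita_proj (smoothNear_extendIn h.smooth_left v).mdiffAt u
  rw [extendIn_self] at h1
  rw [← h1]
  simp only [extendIn, proj_proj]
  rfl

/-- For fields `X, Y` smooth near `x`, the field `(∇_X Y)^Q` is smooth. -/
theorem smoothNear_secondFund (h : IsAdaptedPair n p P Q) (hX : SmoothNear X x)
    (hY : SmoothNear Y x) : SmoothNear (fun y ↦ secondFund P Q y (X y) (Y y)) x := by
  refine (h.smooth_right.smoothNear_proj
    ((h.smooth_left.smoothNear_proj hX).leviCivita (h.smooth_left.smoothNear_proj hY))).congr ?_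
  filter_upwards [hY.eventually] with y hy
  rw [h.proj_leviCivita_proj hy.mdiffAt]

variable {A F : Π x : M, TangentSpace 𝓘(ℝ, E) x}

theorem inner_leviCivita_left (h : IsAdaptedPair n p P Q) (hF : SmoothNear F x)
    (hY : SmoothNear Y x) (hFP : ∀ᶠ y in 𝓝 x, F y ∈ P y) (hYQ : ∀ᶠ y in 𝓝 x, Y y ∈ Q y)
    (v : TangentSpace 𝓘(ℝ, E) x) : ⟪leviCivita F x v, Y x⟫ = -⟪F x, leviCivita Y x v⟫ := by
  refine inner_leviCivita_of_orthogonal hF.mdiffAt hY.mdiffAt ?_ v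
  filter_upwards [hFP, hYQ] with y h1 h2 using h.adapted y _ h1 _ h2

theorem inner_leviCivita_of_mem_left (h : IsAdaptedPair n p P Q) (hF : SmoothNear F x)
    (hFP : ∀ᶠ y in 𝓝 x, F y ∈ P y) (hYQ : Y x ∈ Q x)
    {v : TangentSpace 𝓘(ℝ, E) x} (hv : v ∈ P x) :
    ⟪leviCivita F x v, Y x⟫ = ⟪secondFund P Q x v (F x), Y x⟫ := by
  rw [← h.proj_leviCivita hF.mdiffAt hFP hv, inner_proj_comm, proj_of_mem hYQ]

theorem inner_leviCivita_of_mem_right (h : IsAdaptedPair n p P Q) (hF : SmoothNear F x)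
    (hY : SmoothNear Y x) (hFP : ∀ᶠ y in 𝓝 x, F y ∈ P y) (hYQ : ∀ᶠ y in 𝓝 x, Y y ∈ Q y)
    {v : TangentSpace 𝓘(ℝ, E) x} (hv : v ∈ Q x) :
    ⟪leviCivita F x v, Y x⟫ = -⟪secondFund Q P x v (Y x), F x⟫ := by
  rw [h.inner_leviCivita_left hF hY hFP hYQ, ← h.symm.proj_leviCivita hY.mdiffAt hYQ hv,
    inner_proj_comm, proj_of_mem hFP.self_of_nhds, real_inner_comm]

theorem inner_leviCivita_eq (h : IsAdaptedPair n p P Q) (hF : SmoothNear F x)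
    (hY : SmoothNear Y x) (hFP : ∀ᶠ y in 𝓝 x, F y ∈ P y) (hYQ : ∀ᶠ y in 𝓝 x, Y y ∈ Q y)
    (v : TangentSpace 𝓘(ℝ, E) x) :
    ⟪leviCivita F x v, Y x⟫ =
      ⟪secondFund P Q x v (F x), Y x⟫ - ⟪secondFund Q P x v (Y x), F x⟫ := by
  conv_lhs => rw [← h.proj_add_proj v, map_add, inner_add_left,
    h.inner_leviCivita_of_mem_left hF hFP hYQ.self_of_nhds (proj_mem P x v),
    h.inner_leviCivita_of_mem_right hF hY hFP hYQ (proj_mem Q x v), secondFund_proj_left,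
    secondFund_proj_left]
  rfl

/-! ### The curvature in mixed directions -/

/-- The mixed component of the curvature for fields `A, F` in `P` and `X, Y` in `Q`, in terms of the
second fundamental tensors `B` of `P` and `C` of `Q`:
`⟪R(A, X) F, Y⟫ = ⟪(∇_X B)(A, F), Y⟫ + ⟪(∇_A C)(X, Y), F⟫ + ⟪B(∇_A X, F), Y⟫ + ⟪C(∇_X A, Y), F⟫`. -/
theorem inner_curvatureField (h : IsAdaptedPair n p P Q)
    (hA : SmoothNear A x) (hF : SmoothNear F x) (hX : SmoothNear X x) (hY : SmoothNear Y x)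
    (hAP : ∀ᶠ y in 𝓝 x, A y ∈ P y) (hFP : ∀ᶠ y in 𝓝 x, F y ∈ P y)
    (hXQ : ∀ᶠ y in 𝓝 x, X y ∈ Q y) (hYQ : ∀ᶠ y in 𝓝 x, Y y ∈ Q y) :
    ⟪curvatureField A X F x, Y x⟫ =
      ⟪leviCivita (fun y ↦ secondFund P Q y (A y) (F y)) x (X x), Y x⟫
        - ⟪secondFund P Q x (leviCivita A x (X x)) (F x), Y x⟫
        - ⟪secondFund P Q x (A x) (leviCivita F x (X x)), Y x⟫
      + (⟪leviCivita (fun y ↦ secondFund Q P y (X y) (Y y)) x (A x), F x⟫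
        - ⟪secondFund Q P x (leviCivita X x (A x)) (Y x), F x⟫
        - ⟪secondFund Q P x (X x) (leviCivita Y x (A x)), F x⟫)
      + ⟪secondFund P Q x (leviCivita X x (A x)) (F x), Y x⟫
      + ⟪secondFund Q P x (leviCivita A x (X x)) (Y x), F x⟫ := by
  have hAx := hAP.self_of_nhds
  have hXx := hXQ.self_of_nhds
  have hFx := hFP.self_of_nhds
  have hYx := hYQ.self_of_nhds
  have hAF := hA.leviCivita hF
  have hXF := hX.leviCivita hF
  have hPG := h.smooth_left.smoothNear_proj hAF
  have hPK := h.smooth_left.smoothNear_proj hXF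
  have hQK := h.smooth_right.smoothNear_proj hXF
  have hB := h.smoothNear_secondFund hA hF
  have hC := h.symm.smoothNear_secondFund hX hY
  -- the term `∇_X ∇_A F`: split `∇_A F` into its components
  have e1 : leviCivita (fun y ↦ leviCivita F y (A y)) x =
      leviCivita (fun y ↦ proj P y (leviCivita F y (A y))) x
        + leviCivita (fun y ↦ secondFund P Q y (A y) (F y)) x := by
    rw [← leviCivita_add hPG.mdiffAt hB.mdiffAt, leviCivita_congr (hPG.add hB).mdiffAt]
    filter_upwards [eventually_eventually_nhds.2 hFP, hAP, hF.eventually] with y h1 h2 h3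
    rw [← h.proj_leviCivita h3.mdiffAt h1 h2, h.proj_add_proj]
  have e2 : ⟪leviCivita (fun y ↦ proj P y (leviCivita F y (A y))) x (X x), Y x⟫ =
      -⟪secondFund Q P x (X x) (Y x), leviCivita F x (A x)⟫ := by
    rw [h.inner_leviCivita_of_mem_right hPG hY (.of_forall fun y ↦ proj_mem P y _) hYQ hXx,
      ← inner_proj_comm, proj_of_mem (secondFund_mem _ _)]
  -- the term `∇_A ∇_X F`: split `∇_X F` into its components
  have e3 : leviCivita (fun y ↦ leviCivita F y (X y)) x =
      leviCivita (fun y ↦ proj P y (leviCivita F y (X y))) x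
        + leviCivita (fun y ↦ proj Q y (leviCivita F y (X y))) x := by
    rw [← leviCivita_add hPK.mdiffAt hQK.mdiffAt, leviCivita_congr (hPK.add hQK).mdiffAt]
    exact .of_forall fun y ↦ (h.proj_add_proj _).symm
  have e4 : ⟪leviCivita (fun y ↦ proj P y (leviCivita F y (X y))) x (A x), Y x⟫ =
      ⟪secondFund P Q x (A x) (leviCivita F x (X x)), Y x⟫ := by
    rw [h.inner_leviCivita_of_mem_left hPK (.of_forall fun y ↦ proj_mem P y _) hYx hAx,
      h.secondFund_proj_right]
  -- differentiate `⟪(∇_X F)^Q, Y⟫ = -⟪C(X, Y), F⟫` in the direction of `A`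
  have e5 : ∀ᶠ y in 𝓝 x, ⟪proj Q y (leviCivita F y (X y)), Y y⟫ =
      -⟪secondFund Q P y (X y) (Y y), F y⟫ := by
    filter_upwards [eventually_eventually_nhds.2 hFP, eventually_eventually_nhds.2 hYQ, hXQ,
      hF.eventually, hY.eventually] with y h1 h2 h3 h4 h5
    rw [inner_proj_comm, proj_of_mem h2.self_of_nhds,
      h.inner_leviCivita_of_mem_right h4 h5 h1 h2 h3]
  have e6 := congrArg (fun L ↦ L (A x)) (mvfderiv_congr (E := E) e5)
  have e7 : mvfderiv 𝓘(ℝ, E) (fun y ↦ -⟪secondFund Q P y (X y) (Y y), F y⟫) x (A x) =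
      -mvfderiv 𝓘(ℝ, E) (fun y ↦ ⟪secondFund Q P y (X y) (Y y), F y⟫) x (A x) := by
    rw [mvfderiv_fun_neg]
    rfl
  rw [e7, leviCivita_inner hQK.mdiffAt hY.mdiffAt, leviCivita_inner hC.mdiffAt hF.mdiffAt] at e6
  have hAY := h.smooth_right.smoothNear_proj (hA.leviCivita hY)
  have e8 : ⟪proj Q x (leviCivita F x (X x)), leviCivita Y x (A x)⟫ =
      -⟪secondFund Q P x (X x) (leviCivita Y x (A x)), F x⟫ := by
    rw [inner_proj_comm, h.inner_leviCivita_of_mem_right (Y := fun y ↦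
      proj Q y (leviCivita Y y (A y))) hF hAY hFP (.of_forall fun y ↦ proj_mem Q y _) hXx,
      h.symm.secondFund_proj_right]
  -- the term `∇_{[A, X]} F`
  have e9 := h.inner_leviCivita_eq hF hY hFP hYQ (mlieBracket 𝓘(ℝ, E) A X x)
  rw [leviCivita_sub_swap hA.mdiffAt hX.mdiffAt, ← h.secondFundBilin_apply,
    ← h.symm.secondFundBilin_apply] at e9
  simp only [map_sub, LinearMap.sub_apply, inner_sub_left, secondFundBilin_apply] at e9
  rw [curvatureField, inner_add_left, inner_sub_left, e1, e3, leviCivita_sub_swap hA.mdiffAt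
    hX.mdiffAt, map_sub]
  simp only [_root_.add_apply, inner_add_left, inner_sub_left]
  rw [e2, e4]
  linarith

end IsAdaptedPair

end SecondFundamentalTensor

section Traces

/-! ### Traces in orthonormal frames -/

section LinearAlgebra

variable {V W ι κ : Type*} [NormedAddCommGroup V] [InnerProductSpace ℝ V] [AddCommGroup W]
  [Module ℝ W] [Fintype ι] [Fintype κ]

theorem _root_.Orthonormal.eq_sum_of_mem_span {e : ι → V} (he : Orthonormal ℝ e) {v : V}
    (hv : v ∈ Submodule.span ℝ (Set.range e)) : v = ∑ i, ⟪e i, v⟫ • e i := by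
  have : FiniteDimensional ℝ (Submodule.span ℝ (Set.range e)) :=
    FiniteDimensional.span_of_finite ℝ (Set.finite_range e)
  rw [← Orthonormal.starProjection_eq_sum he rfl, Submodule.starProjection_eq_self_iff.2 hv]

/-- The trace of a bilinear map over an orthonormal family depends only on the span. -/
theorem _root_.Orthonormal.sum_bilin_eq {e : ι → V} {f : κ → V} (he : Orthonormal ℝ e)
    (hf : Orthonormal ℝ f)
    (h : Submodule.span ℝ (Set.range e) = Submodule.span ℝ (Set.range f)) (β : V →ₗ[ℝ] V →ₗ[ℝ] W) :
    ∑ i, β (e i) (e i) = ∑ j, β (f j) (f j) := by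
  have h1 : ∀ i, β (e i) (e i) = ∑ j, ⟪f j, e i⟫ • β (e i) (f j) := fun i ↦ by
    have := congrArg (β (e i))
      (Orthonormal.eq_sum_of_mem_span hf (v := e i) (h ▸ Submodule.subset_span ⟨i, rfl⟩))
    simpa using this
  have h2 : ∀ j, β (f j) (f j) = ∑ i, ⟪f j, e i⟫ • β (e i) (f j) := fun j ↦ by
    have := congrArg (fun v ↦ β v (f j))
      (Orthonormal.eq_sum_of_mem_span he (v := f j) (h ▸ Submodule.subset_span ⟨j, rfl⟩))
    simpa [real_inner_comm (f j)] using this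
  simp only [h1, h2]
  exact Finset.sum_comm

end LinearAlgebra

variable {n p : ℕ} {P Q : Π x : M, Submodule ℝ (TangentSpace 𝓘(ℝ, E) x)} {x : M}

theorem orthonormal_onb (P : Π x : M, Submodule ℝ (TangentSpace 𝓘(ℝ, E) x)) (x : M) :
    Orthonormal ℝ (onb P x) :=
  (stdOrthonormalBasis ℝ (P x)).orthonormal.comp_linearIsometry (P x).subtypeₗᵢ

theorem span_onb (P : Π x : M, Submodule ℝ (TangentSpace 𝓘(ℝ, E) x)) (x : M) :
    Submodule.span ℝ (Set.range (onb P x)) = P x := by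
  have h : onb P x = (P x).subtype ∘ stdOrthonormalBasis ℝ (P x) := rfl
  rw [h, Set.range_comp, Submodule.span_image, ← OrthonormalBasis.coe_toBasis, Basis.span_eq,
    Submodule.map_top, Submodule.range_subtype]

theorem onb_mem (P : Π x : M, Submodule ℝ (TangentSpace 𝓘(ℝ, E) x)) (x : M)
    (a : Fin (finrank ℝ (P x))) : onb P x a ∈ P x :=
  (stdOrthonormalBasis ℝ (P x) a).2

/-- A smooth orthonormal frame of `P` which at `x` is the chosen orthonormal basis of `P x`: rotate
an arbitrary orthonormal frame by a constant matrix. -/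
theorem IsSmoothDistribution.exists_frame_onb (hP : IsSmoothDistribution n P) (x : M) :
    ∃ e : Fin (finrank ℝ (P x)) → Π x : M, TangentSpace 𝓘(ℝ, E) x,
      IsOrthonormalFrameNear P e x ∧ ∀ a, e a x = onb P x a := by
  obtain ⟨s, hs⟩ := hP.exists_frame x
  have hon := hs.orthonormal.self_of_nhds
  have hsp := hs.span_eq.self_of_nhds
  have hex : ∀ a, onb P x a = ∑ b, ⟪s b x, onb P x a⟫ • s b x := fun a ↦
    Orthonormal.eq_sum_of_mem_span hon (by rw [hsp]; exact onb_mem P x a)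
  have horth : ∀ᶠ y in 𝓝 x,
      Orthonormal ℝ fun a ↦ ∑ b, ⟪s b x, onb P x a⟫ • s b y := by
    filter_upwards [hs.orthonormal] with y hy
    have h0 := orthonormal_onb P x
    rw [orthonormal_iff_ite] at h0 ⊢
    intro a c
    rw [← h0 a c, hex a, hex c, hy.inner_sum, hon.inner_sum]
    simp only [← hex]
  refine ⟨fun a y ↦ ∑ b, ⟪s b x, onb P x a⟫ • s b y,
    ⟨fun a ↦ .sum fun b _ ↦ (hs.smooth b).const_smul _, horth, ?_⟩, fun a ↦ (hex a).symm⟩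
  have hrank : ∀ᶠ y in 𝓝 x, finrank ℝ (P y) = n := by
    filter_upwards [hs.orthonormal, hs.span_eq] with y h1 h2
    rw [← h2, finrank_span_eq_card h1.linearIndependent, Fintype.card_fin]
  filter_upwards [horth, hs.span_eq, hrank] with y h1 h2 h3
  refine Submodule.eq_of_le_of_finrank_eq ?_ ?_
  · rw [Submodule.span_le, ← h2]
    rintro _ ⟨a, rfl⟩
    exact Submodule.sum_mem _ fun b _ ↦ Submodule.smul_mem _ _ (Submodule.subset_span ⟨b, rfl⟩)
  · rw [finrank_span_eq_card h1.linearIndependent, Fintype.card_fin, h3, hrank.self_of_nhds]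

theorem meanCurvature_mem (P Q : Π x : M, Submodule ℝ (TangentSpace 𝓘(ℝ, E) x)) (x : M) :
    meanCurvature P Q x ∈ Q x :=
  Submodule.sum_mem _ fun _ _ ↦ Submodule.smul_mem _ _ (proj_mem Q x _)

/-- The connection coefficients of an orthonormal frame are antisymmetric. -/
theorem IsOrthonormalFrameNear.inner_leviCivita {ι : Type*}
    {e : ι → Π x : M, TangentSpace 𝓘(ℝ, E) x}
    (he : IsOrthonormalFrameNear P e x) (a b : ι) (v : TangentSpace 𝓘(ℝ, E) x) :
    ⟪e b x, leviCivita (e a) x v⟫ = -⟪e a x, leviCivita (e b) x v⟫ := by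
  classical
  have h1 : ∀ᶠ y in 𝓝 x, ⟪e a y, e b y⟫ = if a = b then (1 : ℝ) else 0 := by
    filter_upwards [he.orthonormal] with y hy using orthonormal_iff_ite.1 hy a b
  have h2 := leviCivita_inner (he.smooth a).mdiffAt (he.smooth b).mdiffAt v
  rw [mvfderiv_congr (g := fun _ ↦ if a = b then (1 : ℝ) else 0) h1, mvfderiv_const,
    _root_.zero_apply] at h2
  rw [real_inner_comm]
  linarith

namespace IsAdaptedPair

variable {ι κ : Type*} [Fintype ι] [Fintype κ] {e : ι → Π x : M, TangentSpace 𝓘(ℝ, E) x}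
  {f : κ → Π x : M, TangentSpace 𝓘(ℝ, E) x} {X Y : Π x : M, TangentSpace 𝓘(ℝ, E) x}

theorem meanCurvature_eq_sum (h : IsAdaptedPair n p P Q) (he : IsOrthonormalFrameNear P e x) :
    meanCurvature P Q x = ∑ a, secondFund P Q x (e a x) (e a x) := by
  have h1 := Orthonormal.sum_bilin_eq he.orthonormal.self_of_nhds (orthonormal_onb P x)
    (by rw [he.span_eq.self_of_nhds, span_onb]) (h.secondFundBilin x)
  simp only [secondFundBilin_apply] at h1
  rw [meanCurvature, h1]
  refine Finset.sum_congr rfl fun a _ ↦ ?_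
  rw [secondForm_eq]
  module

theorem smoothNear_meanCurvature (h : IsAdaptedPair n p P Q) (x : M) :
    SmoothNear (meanCurvature P Q) x := by
  obtain ⟨e, he⟩ := h.smooth_left.exists_frame x
  have h1 : SmoothNear (fun y ↦ ∑ a, secondFund P Q y (e a y) (e a y)) x :=
    .sum fun a _ ↦ h.smoothNear_secondFund (he.smooth a) (he.smooth a)
  refine h1.congr ?_
  filter_upwards [he.eventually] with y hy using h.meanCurvature_eq_sum hy

/-- The covariant derivative commutes with the trace: `∑ (∇_v B)(e_a, e_a) = ∇_v H`. -/
theorem sum_covDeriv_frame (h : IsAdaptedPair n p P Q) (he : IsOrthonormalFrameNear P e x)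
    (v : TangentSpace 𝓘(ℝ, E) x) :
    ∑ a, (leviCivita (fun y ↦ secondFund P Q y (e a y) (e a y)) x v
      - secondFund P Q x (leviCivita (e a) x v) (e a x)
      - secondFund P Q x (e a x) (leviCivita (e a) x v)) =
    leviCivita (meanCurvature P Q) x v := by
  have hs : ∀ a, SmoothNear (fun y ↦ secondFund P Q y (e a y) (e a y)) x := fun a ↦
    h.smoothNear_secondFund (he.smooth a) (he.smooth a)
  have hm : ∀ᶠ y in 𝓝 x, meanCurvature P Q y = ∑ a, secondFund P Q y (e a y) (e a y) := by
    filter_upwards [he.eventually] with y hy using h.meanCurvature_eq_sum hy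
  rw [leviCivita_congr (SmoothNear.sum fun a _ ↦ hs a).mdiffAt hm,
    leviCivita_sum fun a _ ↦ (hs a).mdiffAt, _root_.sum_apply]
  have h1 : ∀ a, secondFund P Q x (leviCivita (e a) x v) (e a x) =
      ∑ b, ⟪e b x, leviCivita (e a) x v⟫ • secondFund P Q x (e b x) (e a x) := fun a ↦ by
    rw [← secondFund_proj_left, he.proj_eq_sum, ← h.secondFundBilin_apply]
    simp [secondFundBilin_apply]
  have h2 : ∀ a, secondFund P Q x (e a x) (leviCivita (e a) x v) =
      ∑ b, ⟪e b x, leviCivita (e a) x v⟫ • secondFund P Q x (e a x) (e b x) := fun a ↦ by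
    rw [← h.secondFund_proj_right, he.proj_eq_sum, ← h.secondFundBilin_apply]
    simp [secondFundBilin_apply]
  have h3 : ∑ a, secondFund P Q x (leviCivita (e a) x v) (e a x) =
      -∑ a, secondFund P Q x (e a x) (leviCivita (e a) x v) := by
    simp only [h1, h2]
    rw [Finset.sum_comm, ← Finset.sum_neg_distrib]
    refine Finset.sum_congr rfl fun a _ ↦ ?_
    rw [← Finset.sum_neg_distrib]
    refine Finset.sum_congr rfl fun b _ ↦ ?_
    rw [he.inner_leviCivita, neg_smul]
  simp only [Finset.sum_sub_distrib, h3]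
  abel

/-- The trace over `P` of the mixed curvature, for fields `X, Y` in `Q`. -/
theorem sum_inner_curvatureField (h : IsAdaptedPair n p P Q)
    (he : IsOrthonormalFrameNear P e x) (hf : IsOrthonormalFrameNear Q f x)
    (hX : SmoothNear X x) (hY : SmoothNear Y x)
    (hXQ : ∀ᶠ y in 𝓝 x, X y ∈ Q y) (hYQ : ∀ᶠ y in 𝓝 x, Y y ∈ Q y) :
    ∑ a, ⟪curvatureField (e a) X (e a) x, Y x⟫ =
      ⟪leviCivita (meanCurvature P Q) x (X x), Y x⟫
      + ∑ a, ⟪leviCivita (fun y ↦ secondFund Q P y (X y) (Y y)) x (e a x)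
        - secondFund Q P x (leviCivita X x (e a x)) (Y x)
        - secondFund Q P x (X x) (leviCivita Y x (e a x)), e a x⟫
      - ∑ a, ∑ b, ⟪secondFund P Q x (e a x) (e b x), X x⟫ *
          ⟪secondFund P Q x (e b x) (e a x), Y x⟫
      - ∑ a, ∑ i, ⟪secondFund Q P x (X x) (f i x), e a x⟫ *
          ⟪secondFund Q P x (f i x) (Y x), e a x⟫ := by
  have heP : ∀ a, ∀ᶠ y in 𝓝 x, e a y ∈ P y := fun a ↦ he.mem.mono fun y hy ↦ hy a
  have hfQ : ∀ i, ∀ᶠ y in 𝓝 x, f i y ∈ Q y := fun i ↦ hf.mem.mono fun y hy ↦ hy i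
  have h1 : ∀ a, ⟪secondFund P Q x (leviCivita X x (e a x)) (e a x), Y x⟫ =
      -∑ b, ⟪secondFund P Q x (e a x) (e b x), X x⟫ *
        ⟪secondFund P Q x (e b x) (e a x), Y x⟫ := fun a ↦ by
    rw [← secondFund_proj_left, he.proj_eq_sum, ← h.secondFundBilin_apply, map_sum,
      LinearMap.sum_apply, sum_inner, ← Finset.sum_neg_distrib]
    refine Finset.sum_congr rfl fun b _ ↦ ?_
    rw [real_inner_comm (leviCivita X x (e a x)),
      h.symm.inner_leviCivita_of_mem_right hX (he.smooth b) hXQ (heP b)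
      (heP a).self_of_nhds]
    simp [secondFundBilin_apply, inner_smul_left]
  have h2 : ∀ a, ⟪secondFund Q P x (leviCivita (e a) x (X x)) (Y x), e a x⟫ =
      -∑ i, ⟪secondFund Q P x (X x) (f i x), e a x⟫ *
        ⟪secondFund Q P x (f i x) (Y x), e a x⟫ := fun a ↦ by
    rw [← secondFund_proj_left, hf.proj_eq_sum, ← h.symm.secondFundBilin_apply, map_sum,
      LinearMap.sum_apply, sum_inner, ← Finset.sum_neg_distrib]
    refine Finset.sum_congr rfl fun i _ ↦ ?_
    rw [real_inner_comm (leviCivita (e a) x (X x)),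
      h.inner_leviCivita_of_mem_right (he.smooth a) (hf.smooth i) (heP a)
      (hfQ i) hXQ.self_of_nhds]
    simp [secondFundBilin_apply, inner_smul_left]
  rw [← h.sum_covDeriv_frame he, sum_inner, ← Finset.sum_add_distrib, ← Finset.sum_sub_distrib,
    ← Finset.sum_sub_distrib]
  refine Finset.sum_congr rfl fun a _ ↦ ?_
  rw [h.inner_curvatureField (he.smooth a) (he.smooth a) hX hY (heP a) (heP a) hXQ hYQ, h1, h2]
  simp only [inner_sub_left]
  ring

/-- The trace over the tangent space splits into the traces over `P` and `Q`. -/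
theorem sum_stdOrthonormalBasis (h : IsAdaptedPair n p P Q)
    (L : TangentSpace 𝓘(ℝ, E) x →ₗ[ℝ] TangentSpace 𝓘(ℝ, E) x) :
    ∑ k, ⟪L (stdOrthonormalBasis ℝ (TangentSpace 𝓘(ℝ, E) x) k),
        stdOrthonormalBasis ℝ (TangentSpace 𝓘(ℝ, E) x) k⟫ =
      ∑ a, ⟪L (onb P x a), onb P x a⟫ + ∑ i, ⟪L (onb Q x i), onb Q x i⟫ := by
  have hon : Orthonormal ℝ (Sum.elim (onb P x) (onb Q x)) := by
    have h1 := orthonormal_iff_ite.1 (orthonormal_onb P x)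
    have h2 := orthonormal_iff_ite.1 (orthonormal_onb Q x)
    rw [orthonormal_iff_ite]
    rintro (a | i) (b | j)
    · simpa using h1 a b
    · simpa using h.adapted x _ (onb_mem P x a) _ (onb_mem Q x j)
    · simpa using h.symm.adapted x _ (onb_mem Q x i) _ (onb_mem P x b)
    · simpa using h2 i j
  have hsp : Submodule.span ℝ (Set.range (Sum.elim (onb P x) (onb Q x))) = ⊤ := by
    rw [Set.Sum.elim_range, Submodule.span_union, span_onb, span_onb, (h.isCompl x).sup_eq_top]
  have hstd : Submodule.span ℝ (Set.range (stdOrthonormalBasis ℝ (TangentSpace 𝓘(ℝ, E) x))) =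
      ⊤ := by
    rw [← OrthonormalBasis.coe_toBasis, Basis.span_eq]
  have := Orthonormal.sum_bilin_eq (stdOrthonormalBasis ℝ (TangentSpace 𝓘(ℝ, E) x)).orthonormal hon
    (by rw [hsp, hstd]) ((innerₗ (TangentSpace 𝓘(ℝ, E) x)).comp L)
  simpa using this

end IsAdaptedPair

end Traces

section StructureEquations

/-! ### Contractions of the second fundamental form and the integrability tensor -/

variable {n p : ℕ} {P Q : Π x : M, Submodule ℝ (TangentSpace 𝓘(ℝ, E) x)} {x : M}

theorem eq_sum_onb {v : TangentSpace 𝓘(ℝ, E) x} (hv : v ∈ P x) :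
    v = ∑ a, ⟪onb P x a, v⟫ • onb P x a :=
  Orthonormal.eq_sum_of_mem_span (orthonormal_onb P x) (by rwa [span_onb])

theorem norm_sq_eq_sum_onb {v : TangentSpace 𝓘(ℝ, E) x} (hv : v ∈ P x) :
    ‖v‖ ^ 2 = ∑ a, ⟪v, onb P x a⟫ ^ 2 := by
  rw [← real_inner_self_eq_norm_sq]
  conv_lhs =>
    arg 2
    rw [eq_sum_onb hv]
  rw [sum_inner]
  refine Finset.sum_congr rfl fun a _ ↦ ?_
  rw [real_inner_smul_left, real_inner_comm v, sq]

theorem secondForm_symm (u v : TangentSpace 𝓘(ℝ, E) x) :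
    secondForm P Q x u v = secondForm P Q x v u := by
  rw [secondForm_eq, secondForm_eq, add_comm]

theorem secondForm_mem (u v : TangentSpace 𝓘(ℝ, E) x) : secondForm P Q x u v ∈ Q x :=
  Submodule.smul_mem _ _ (proj_mem Q x _)

theorem integrability_mem (u v : TangentSpace 𝓘(ℝ, E) x) : integrability P Q x u v ∈ Q x :=
  Submodule.smul_mem _ _ (proj_mem Q x _)

theorem inner_dualOp (β : TangentSpace 𝓘(ℝ, E) x →ₗ[ℝ] TangentSpace 𝓘(ℝ, E) x →ₗ[ℝ]
      TangentSpace 𝓘(ℝ, E) x)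
    {S : Π x : M, TangentSpace 𝓘(ℝ, E) x → TangentSpace 𝓘(ℝ, E) x → TangentSpace 𝓘(ℝ, E) x}
    (hS : ∀ u v, S x u v = β u v) (Z X : TangentSpace 𝓘(ℝ, E) x) {w : TangentSpace 𝓘(ℝ, E) x}
    (hw : w ∈ P x) : ⟪dualOp P S x Z X, w⟫ = ⟪S x X w, Z⟫ := by
  conv_rhs => rw [hS, eq_sum_onb hw]
  simp [dualOp, sum_inner, inner_smul_left, hS, mul_comm]

theorem inner_dualOp_dualOp (β : TangentSpace 𝓘(ℝ, E) x →ₗ[ℝ] TangentSpace 𝓘(ℝ, E) x →ₗ[ℝ]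
      TangentSpace 𝓘(ℝ, E) x)
    {S S' : Π x : M, TangentSpace 𝓘(ℝ, E) x → TangentSpace 𝓘(ℝ, E) x → TangentSpace 𝓘(ℝ, E) x}
    (hS : ∀ u v, S x u v = β u v) (Z Z' X : TangentSpace 𝓘(ℝ, E) x)
    {w : TangentSpace 𝓘(ℝ, E) x} (hw : w ∈ P x) :
    ⟪dualOp P S x Z' (dualOp P S' x Z X), w⟫ =
      ∑ b, ⟪S' x X (onb P x b), Z⟫ * ⟪S x (onb P x b) w, Z'⟫ := by
  rw [inner_dualOp β hS _ _ hw, hS, dualOp]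
  simp [sum_inner, inner_smul_left, hS]

theorem partialRicci_symm (X Y : TangentSpace 𝓘(ℝ, E) x) :
    partialRicci P Q x X Y = partialRicci P Q x Y X :=
  Finset.sum_congr rfl fun _ _ ↦ inner_curvature_symm _ _ _ _

namespace IsAdaptedPair

variable {X Y : TangentSpace 𝓘(ℝ, E) x}

theorem secondFund_eq (h : IsAdaptedPair n p P Q) (u v : TangentSpace 𝓘(ℝ, E) x) :
    secondFund P Q x u v = secondForm P Q x u v + integrability P Q x u v := by
  rw [secondForm_eq, integrability_eq h.smooth_left]
  module

theorem secondFund_swap (h : IsAdaptedPair n p P Q) (u v : TangentSpace 𝓘(ℝ, E) x) :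
    secondFund P Q x v u = secondForm P Q x u v - integrability P Q x u v := by
  rw [secondForm_eq, integrability_eq h.smooth_left]
  module

theorem integrability_swap (h : IsAdaptedPair n p P Q) (u v : TangentSpace 𝓘(ℝ, E) x) :
    integrability P Q x u v = -integrability P Q x v u := by
  rw [integrability_eq h.smooth_left, integrability_eq h.smooth_left]
  module

theorem secondForm_eq_bilin (h : IsAdaptedPair n p P Q) (u v : TangentSpace 𝓘(ℝ, E) x) :
    secondForm P Q x u v =
      ((1 / 2 : ℝ) • (h.secondFundBilin x + (h.secondFundBilin x).flip)) u v := by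
  rw [secondForm_eq]; rfl

theorem integrability_eq_bilin (h : IsAdaptedPair n p P Q) (u v : TangentSpace 𝓘(ℝ, E) x) :
    integrability P Q x u v =
      ((1 / 2 : ℝ) • (h.secondFundBilin x - (h.secondFundBilin x).flip)) u v := by
  rw [integrability_eq h.smooth_left]; rfl

theorem casoratiA_eq (h : IsAdaptedPair n p P Q) (hY : Y ∈ P x) :
    casoratiA P Q x X Y = ∑ i, ∑ b, ⟪secondForm P Q x X (onb P x b), onb Q x i⟫ *
      ⟪secondForm P Q x (onb P x b) Y, onb Q x i⟫ := by
  rw [casoratiA, sum_inner]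
  exact Finset.sum_congr rfl fun i _ ↦ inner_dualOp_dualOp _ h.secondForm_eq_bilin _ _ _ hY

theorem casoratiT_eq (h : IsAdaptedPair n p P Q) (hY : Y ∈ P x) :
    casoratiT P Q x X Y = ∑ i, ∑ b, ⟪integrability P Q x X (onb P x b), onb Q x i⟫ *
      ⟪integrability P Q x (onb P x b) Y, onb Q x i⟫ := by
  rw [casoratiT, sum_inner]
  exact Finset.sum_congr rfl fun i _ ↦ inner_dualOp_dualOp _ h.integrability_eq_bilin _ _ _ hY

theorem mixedAT_eq (h : IsAdaptedPair n p P Q) (hY : Y ∈ P x) :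
    mixedAT P Q x X Y = ∑ i, ∑ b, (⟪integrability P Q x X (onb P x b), onb Q x i⟫ *
        ⟪secondForm P Q x (onb P x b) Y, onb Q x i⟫ +
      ⟪secondForm P Q x X (onb P x b), onb Q x i⟫ *
        ⟪integrability P Q x (onb P x b) Y, onb Q x i⟫) := by
  rw [mixedAT, sum_inner]
  refine Finset.sum_congr rfl fun i _ ↦ ?_
  rw [inner_add_left, Finset.sum_add_distrib]
  exact congrArg₂ _ (inner_dualOp_dualOp _ h.secondForm_eq_bilin _ _ _ hY)
    (inner_dualOp_dualOp _ h.integrability_eq_bilin _ _ _ hY)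

theorem psi_eq (h : IsAdaptedPair n p P Q) :
    psi P Q x X Y = ∑ a, ∑ b, (⟪secondForm P Q x (onb P x a) (onb P x b), X⟫ *
        ⟪secondForm P Q x (onb P x b) (onb P x a), Y⟫ +
      ⟪integrability P Q x (onb P x a) (onb P x b), X⟫ *
        ⟪integrability P Q x (onb P x b) (onb P x a), Y⟫) := by
  rw [psi]
  refine Finset.sum_congr rfl fun a _ ↦ ?_
  rw [inner_add_left, Finset.sum_add_distrib]
  exact congrArg₂ _ (inner_dualOp_dualOp _ h.secondForm_eq_bilin _ _ _ (onb_mem P x a))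
    (inner_dualOp_dualOp _ h.integrability_eq_bilin _ _ _ (onb_mem P x a))

theorem casorati_add_mixedAT (h : IsAdaptedPair n p P Q) (hY : Y ∈ P x) :
    ∑ i, ∑ b, ⟪secondFund P Q x X (onb P x b), onb Q x i⟫ *
        ⟪secondFund P Q x (onb P x b) Y, onb Q x i⟫ =
      casoratiA P Q x X Y + casoratiT P Q x X Y + mixedAT P Q x X Y := by
  rw [h.casoratiA_eq hY, h.casoratiT_eq hY, h.mixedAT_eq hY]
  simp only [← Finset.sum_add_distrib, h.secondFund_eq, inner_add_left]
  refine Finset.sum_congr rfl fun i _ ↦ Finset.sum_congr rfl fun b _ ↦ ?_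
  ring

theorem sum_secondFund_mul_swap (h : IsAdaptedPair n p P Q) :
    ∑ a, ∑ b, ⟪secondFund P Q x (onb P x a) (onb P x b), X⟫ *
      ⟪secondFund P Q x (onb P x b) (onb P x a), Y⟫ = psi P Q x X Y := by
  -- the mixed products of symmetric and antisymmetric parts cancel
  have h0 : ∑ a, ∑ b, (⟪integrability P Q x (onb P x a) (onb P x b), X⟫ *
        ⟪secondForm P Q x (onb P x a) (onb P x b), Y⟫ -
      ⟪secondForm P Q x (onb P x a) (onb P x b), X⟫ *
        ⟪integrability P Q x (onb P x a) (onb P x b), Y⟫) = 0 := by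
    refine self_eq_neg.1 ?_
    conv_lhs => rw [Finset.sum_comm]
    rw [← Finset.sum_neg_distrib]
    refine Finset.sum_congr rfl fun a _ ↦ ?_
    rw [← Finset.sum_neg_distrib]
    refine Finset.sum_congr rfl fun b _ ↦ ?_
    rw [h.integrability_swap (onb P x b), secondForm_symm (onb P x b), inner_neg_left,
      inner_neg_left]
    ring
  rw [h.psi_eq, ← add_zero (∑ a, ∑ b, (_ + _ : ℝ)), ← h0, ← Finset.sum_add_distrib]
  refine Finset.sum_congr rfl fun a _ ↦ ?_
  rw [← Finset.sum_add_distrib]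
  refine Finset.sum_congr rfl fun b _ ↦ ?_
  rw [h.secondFund_eq, h.secondFund_swap, h.integrability_swap (onb P x b),
    secondForm_symm (onb P x b)]
  simp only [inner_add_left, inner_sub_left, inner_neg_left]
  ring

theorem casoratiA_symm (h : IsAdaptedPair n p P Q) (hX : X ∈ P x) (hY : Y ∈ P x) :
    casoratiA P Q x X Y = casoratiA P Q x Y X := by
  rw [h.casoratiA_eq hX, h.casoratiA_eq hY]
  refine Finset.sum_congr rfl fun i _ ↦ Finset.sum_congr rfl fun b _ ↦ ?_
  rw [secondForm_symm X, secondForm_symm Y, mul_comm]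

theorem casoratiT_symm (h : IsAdaptedPair n p P Q) (hX : X ∈ P x) (hY : Y ∈ P x) :
    casoratiT P Q x X Y = casoratiT P Q x Y X := by
  rw [h.casoratiT_eq hX, h.casoratiT_eq hY]
  refine Finset.sum_congr rfl fun i _ ↦ Finset.sum_congr rfl fun b _ ↦ ?_
  rw [h.integrability_swap X, h.integrability_swap Y, inner_neg_left, inner_neg_left]
  ring

theorem mixedAT_antisymm (h : IsAdaptedPair n p P Q) (hX : X ∈ P x) (hY : Y ∈ P x) :
    mixedAT P Q x X Y = -mixedAT P Q x Y X := by
  rw [h.mixedAT_eq hX, h.mixedAT_eq hY, ← Finset.sum_neg_distrib]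
  refine Finset.sum_congr rfl fun i _ ↦ ?_
  rw [← Finset.sum_neg_distrib]
  refine Finset.sum_congr rfl fun b _ ↦ ?_
  rw [h.integrability_swap X, h.integrability_swap Y, secondForm_symm X, secondForm_symm Y,
    inner_neg_left, inner_neg_left]
  ring

theorem psi_symm (h : IsAdaptedPair n p P Q) : psi P Q x X Y = psi P Q x Y X := by
  rw [h.psi_eq, h.psi_eq, Finset.sum_comm]
  refine Finset.sum_congr rfl fun a _ ↦ Finset.sum_congr rfl fun b _ ↦ ?_
  ring

theorem sum_psi_onb (h : IsAdaptedPair n p P Q) (x : M) :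
    ∑ i, psi P Q x (onb Q x i) (onb Q x i) =
      sqNorm P (secondForm P Q) x - sqNorm P (integrability P Q) x := by
  simp only [h.psi_eq, sqNorm, norm_sq_eq_sum_onb (secondForm_mem _ _),
    norm_sq_eq_sum_onb (integrability_mem _ _)]
  rw [Finset.sum_comm, ← Finset.sum_sub_distrib]
  refine Finset.sum_congr rfl fun a _ ↦ ?_
  rw [Finset.sum_comm, ← Finset.sum_sub_distrib]
  refine Finset.sum_congr rfl fun b _ ↦ ?_
  rw [← Finset.sum_sub_distrib]
  refine Finset.sum_congr rfl fun i _ ↦ ?_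
  rw [secondForm_symm (onb P x b), h.integrability_swap (onb P x b), inner_neg_left]
  ring

/-! ### Divergences -/

theorem covDerivTensor_secondForm (h : IsAdaptedPair n p P Q) (v X Y : TangentSpace 𝓘(ℝ, E) x) :
    covDerivTensor (secondForm P Q) x v X Y = (1 / 2 : ℝ) •
      (covDerivTensor (secondFund P Q) x v X Y + covDerivTensor (secondFund P Q) x v Y X) := by
  have hXY := h.smoothNear_secondFund (SmoothNear.extend X) (SmoothNear.extend Y)
  have hYX := h.smoothNear_secondFund (SmoothNear.extend Y) (SmoothNear.extend X)
  simp only [covDerivTensor, secondForm_eq]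
  rw [leviCivita_const_smul _ (hXY.add hYX).mdiffAt, leviCivita_add hXY.mdiffAt hYX.mdiffAt]
  simp only [_root_.add_apply, _root_.smul_apply]
  module

theorem covDerivTensor_integrability (h : IsAdaptedPair n p P Q) (v X Y : TangentSpace 𝓘(ℝ, E) x) :
    covDerivTensor (integrability P Q) x v X Y = (1 / 2 : ℝ) •
      (covDerivTensor (secondFund P Q) x v X Y - covDerivTensor (secondFund P Q) x v Y X) := by
  have hXY := h.smoothNear_secondFund (SmoothNear.extend X) (SmoothNear.extend Y)
  have hYX := h.smoothNear_secondFund (SmoothNear.extend Y) (SmoothNear.extend X)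
  simp only [covDerivTensor, integrability_eq h.smooth_left]
  rw [leviCivita_const_smul _ (hXY.sub hYX).mdiffAt, leviCivita_sub hXY.mdiffAt hYX.mdiffAt]
  simp only [_root_.sub_apply, _root_.smul_apply]
  module

theorem proj_leviCivita_extendIn (h : IsAdaptedPair n p P Q) (hX : X ∈ P x)
    (v : TangentSpace 𝓘(ℝ, E) x) :
    proj P x (leviCivita (extendIn P X) x v) = proj P x (leviCivita (extend E X) x v) := by
  have h1 : ∀ᶠ y in 𝓝 x, extend E X y = extendIn P X y + extendIn Q X y :=
    .of_forall fun y ↦ (h.proj_add_proj _).symm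
  have hP := smoothNear_extendIn h.smooth_left X
  have hQ := smoothNear_extendIn h.smooth_right X
  rw [leviCivita_congr (hP.add hQ).mdiffAt h1, leviCivita_add hP.mdiffAt hQ.mdiffAt,
    _root_.add_apply, map_add, left_eq_add]
  refine ext_inner_right ℝ fun w ↦ ?_
  have hw := smoothNear_extendIn h.smooth_left w
  rw [inner_proj_comm, ← extendIn_self w, h.symm.inner_leviCivita_left hQ hw
    (.of_forall (extendIn_mem X)) (.of_forall (extendIn_mem w)), extendIn_self X,
    h.proj_right_eq_zero hX]
  simp

/-- The covariant derivative of the second fundamental tensor may be computed from extensions of the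
arguments to fields in `P`. -/
theorem covDerivTensor_secondFund (h : IsAdaptedPair n p P Q) (hX : X ∈ P x) (hY : Y ∈ P x)
    (v : TangentSpace 𝓘(ℝ, E) x) :
    covDerivTensor (secondFund P Q) x v X Y =
      leviCivita (fun y ↦ secondFund P Q y (extendIn P X y) (extendIn P Y y)) x v
        - secondFund P Q x (leviCivita (extendIn P X) x v) Y
        - secondFund P Q x X (leviCivita (extendIn P Y) x v) := by
  rw [covDerivTensor]
  simp only [extendIn, secondFund_proj_left, h.secondFund_proj_right]
  rw [← secondFund_proj_left, ← h.secondFund_proj_right X, ← h.proj_leviCivita_extendIn hX,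
    ← h.proj_leviCivita_extendIn hY, secondFund_proj_left, h.secondFund_proj_right]

/-- `∑ ⟪(∇_{e_i} h)(X, Y), e_i⟫ = -⟪h(X, Y), ∑ (∇_{e_i} e_i)^Q⟫`, the sum over an orthonormal basis
of `P`, since `h` takes values in `Q`. -/
theorem sum_covDerivTensor_secondForm (h : IsAdaptedPair n p P Q) (X Y : TangentSpace 𝓘(ℝ, E) x) :
    ∑ i, ⟪covDerivTensor (secondForm P Q) x (onb P x i) X Y, onb P x i⟫ =
      -⟪secondForm P Q x X Y, meanCurvature P Q x⟫ := by
  have hs : SmoothNear (fun y ↦ secondForm P Q y (extend E X y) (extend E Y y)) x := by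
    have hXY := h.smoothNear_secondFund (SmoothNear.extend X) (SmoothNear.extend Y)
    have hYX := h.smoothNear_secondFund (SmoothNear.extend Y) (SmoothNear.extend X)
    simp only [secondForm_eq]
    exact (hXY.add hYX).const_smul _
  rw [meanCurvature, inner_sum, ← Finset.sum_neg_distrib]
  refine Finset.sum_congr rfl fun i _ ↦ ?_
  have hi := onb_mem P x i
  have hf := smoothNear_extendIn h.smooth_left (onb P x i)
  have hfx : extendIn P (onb P x i) x = onb P x i := by rw [extendIn_self, proj_of_mem hi]
  have h1 := h.symm.inner_leviCivita_of_mem_right hs hf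
    (.of_forall fun y ↦ secondForm_mem _ _) (.of_forall (extendIn_mem _)) hi
  rw [hfx, extend_apply_self, extend_apply_self] at h1
  have hii : secondForm P Q x (onb P x i) (onb P x i) =
      secondFund P Q x (onb P x i) (onb P x i) := by
    rw [secondForm_eq]
    module
  rw [covDerivTensor, inner_sub_left, inner_sub_left, h1,
    h.symm.adapted x _ (secondForm_mem _ _) _ hi, h.symm.adapted x _ (secondForm_mem _ _) _ hi,
    sub_zero, sub_zero, hii, real_inner_comm]

theorem covDerivTensor_secondForm_linear (h : IsAdaptedPair n p P Q)
    (X Y : TangentSpace 𝓘(ℝ, E) x) :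
    ∃ L : TangentSpace 𝓘(ℝ, E) x →ₗ[ℝ] TangentSpace 𝓘(ℝ, E) x,
      ∀ v, L v = covDerivTensor (secondForm P Q) x v X Y := by
  let β := (1 / 2 : ℝ) • (h.secondFundBilin x + (h.secondFundBilin x).flip)
  refine ⟨(leviCivita (fun y ↦ secondForm P Q y (extend E X y) (extend E Y y)) x).toLinearMap
    - (β.flip Y).comp (leviCivita (extend E X) x).toLinearMap
    - (β X).comp (leviCivita (extend E Y) x).toLinearMap, fun v ↦ ?_⟩
  rw [covDerivTensor, h.secondForm_eq_bilin, h.secondForm_eq_bilin]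
  rfl

theorem divTensor_secondForm (h : IsAdaptedPair n p P Q) (X Y : TangentSpace 𝓘(ℝ, E) x) :
    divTensor (secondForm P Q) x X Y =
      partialDivTensor Q (secondForm P Q) x X Y - ⟪secondForm P Q x X Y, meanCurvature P Q x⟫ := by
  obtain ⟨L, hL⟩ := h.covDerivTensor_secondForm_linear X Y
  have := h.sum_stdOrthonormalBasis L
  simp only [hL] at this
  rw [divTensor, this, h.sum_covDerivTensor_secondForm, partialDivTensor]
  ring

theorem partialDivTensor_secondForm (h : IsAdaptedPair n p P Q) (X Y : TangentSpace 𝓘(ℝ, E) x) :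
    partialDivTensor Q (secondForm P Q) x X Y = 1 / 2 *
      (partialDivTensor Q (secondFund P Q) x X Y + partialDivTensor Q (secondFund P Q) x Y X) := by
  simp only [partialDivTensor, h.covDerivTensor_secondForm, inner_smul_left, inner_add_left,
    ← Finset.sum_add_distrib, Finset.mul_sum]
  simp

theorem partialDivTensor_integrability (h : IsAdaptedPair n p P Q)
    (X Y : TangentSpace 𝓘(ℝ, E) x) :
    partialDivTensor Q (integrability P Q) x X Y = 1 / 2 *
      (partialDivTensor Q (secondFund P Q) x X Y - partialDivTensor Q (secondFund P Q) x Y X) := by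
  simp only [partialDivTensor, h.covDerivTensor_integrability, inner_smul_left, inner_sub_left,
    ← Finset.sum_sub_distrib, Finset.mul_sum]
  simp

/-! ### The structure equations -/

/-- Riccati equation: the partial Ricci tensor in terms of the full second fundamental tensors,
before splitting into symmetric and antisymmetric parts. -/
theorem partialRicci_eq (h : IsAdaptedPair n p P Q) (hX : X ∈ Q x) (hY : Y ∈ Q x) :
    partialRicci P Q x X Y = ⟪leviCivita (meanCurvature P Q) x X, Y⟫
      + partialDivTensor P (secondFund Q P) x X Y - psi P Q x X Y
      - (casoratiA Q P x X Y + casoratiT Q P x X Y + mixedAT Q P x X Y) := by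
  obtain ⟨e, he, hex⟩ := h.smooth_left.exists_frame_onb x
  obtain ⟨f, hf, hfx⟩ := h.smooth_right.exists_frame_onb x
  have hXs := smoothNear_extendIn h.smooth_right X
  have hYs := smoothNear_extendIn h.smooth_right Y
  have hXx : extendIn Q X x = X := by rw [extendIn_self, proj_of_mem hX]
  have hYx : extendIn Q Y x = Y := by rw [extendIn_self, proj_of_mem hY]
  have key := h.sum_inner_curvatureField he hf hXs hYs (.of_forall (extendIn_mem X))
    (.of_forall (extendIn_mem Y))
  simp only [hXx, hYx, hex, hfx] at key
  simp only [← h.symm.covDerivTensor_secondFund hX hY] at key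
  rw [h.sum_secondFund_mul_swap, h.symm.casorati_add_mixedAT hY] at key
  rw [partialDivTensor, ← key, partialRicci]
  refine Finset.sum_congr rfl fun a _ ↦ ?_
  rw [← curvature_apply (he.smooth a) hXs (he.smooth a), hex, hXx, proj_of_mem hX, proj_of_mem hY]

/-- The symmetric part of the Riccati equation. -/
theorem partialRicci_symm_part (h : IsAdaptedPair n p P Q) (hX : X ∈ Q x) (hY : Y ∈ Q x) :
    partialRicci P Q x X Y - divTensor (secondForm Q P) x X Y
      - ⟪secondForm Q P x X Y, meanCurvature Q P x⟫
      + casoratiA Q P x X Y + casoratiT Q P x X Y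
      + psi P Q x X Y - deformation (meanCurvature P Q) x X Y = 0 := by
  have h1 := h.partialRicci_eq hX hY
  have h2 := h.partialRicci_eq hY hX
  rw [partialRicci_symm, h.psi_symm, h.symm.casoratiA_symm hY hX, h.symm.casoratiT_symm hY hX,
    h.symm.mixedAT_antisymm hY hX] at h2
  rw [h.symm.divTensor_secondForm, h.symm.partialDivTensor_secondForm, deformation]
  linarith

/-- The antisymmetric part of the Riccati equation. -/
theorem partialRicci_antisymm_part (h : IsAdaptedPair n p P Q) (hX : X ∈ Q x) (hY : Y ∈ Q x) :
    antisymDeriv (meanCurvature P Q) x X Y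
      + partialDivTensor P (integrability Q P) x X Y - mixedAT Q P x X Y = 0 := by
  have h1 := h.partialRicci_eq hX hY
  have h2 := h.partialRicci_eq hY hX
  rw [partialRicci_symm, h.psi_symm, h.symm.casoratiA_symm hY hX, h.symm.casoratiT_symm hY hX,
    h.symm.mixedAT_antisymm hY hX] at h2
  rw [h.symm.partialDivTensor_integrability, antisymDeriv]
  linarith

theorem sum_inner_leviCivita_meanCurvature (h : IsAdaptedPair n p P Q) (x : M) :
    ∑ a, ⟪leviCivita (meanCurvature P Q) x (onb P x a), onb P x a⟫ =
      -‖meanCurvature P Q x‖ ^ 2 := by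
  obtain ⟨e, he, hex⟩ := h.smooth_left.exists_frame_onb x
  have heP : ∀ a, ∀ᶠ y in 𝓝 x, e a y ∈ P y := fun a ↦ he.mem.mono fun y hy ↦ hy a
  rw [← real_inner_self_eq_norm_sq]
  conv_rhs =>
    arg 1
    arg 2
    rw [h.meanCurvature_eq_sum he]
  rw [sum_inner, ← Finset.sum_neg_distrib]
  refine Finset.sum_congr rfl fun a _ ↦ ?_
  rw [← hex, h.symm.inner_leviCivita_of_mem_right (h.smoothNear_meanCurvature x) (he.smooth a)
    (.of_forall fun y ↦ meanCurvature_mem P Q y) (heP a) (heP a).self_of_nhds]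

theorem divergence_meanCurvature (h : IsAdaptedPair n p P Q) (x : M) :
    divergence (fun y ↦ meanCurvature P Q y + meanCurvature Q P y) x =
      ∑ i, ⟪leviCivita (meanCurvature P Q) x (onb Q x i), onb Q x i⟫ - ‖meanCurvature P Q x‖ ^ 2
      + (∑ a, ⟪leviCivita (meanCurvature Q P) x (onb P x a), onb P x a⟫
        - ‖meanCurvature Q P x‖ ^ 2) := by
  have h1 := h.sum_stdOrthonormalBasis
    (leviCivita (fun y ↦ meanCurvature P Q y + meanCurvature Q P y) x).toLinearMap
  rw [leviCivita_add (h.smoothNear_meanCurvature x).mdiffAt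
    (h.symm.smoothNear_meanCurvature x).mdiffAt] at h1
  rw [divergence, leviCivita_add (h.smoothNear_meanCurvature x).mdiffAt
    (h.symm.smoothNear_meanCurvature x).mdiffAt]
  refine h1.trans ?_
  simp only [ContinuousLinearMap.coe_coe, _root_.add_apply, inner_add_left,
    Finset.sum_add_distrib, h.sum_inner_leviCivita_meanCurvature,
    h.symm.sum_inner_leviCivita_meanCurvature]
  ring

/-- The trace of the Riccati equation. -/
theorem mixedScalar_eq (h : IsAdaptedPair n p P Q) (x : M) :
    mixedScalar P Q x =
      ‖meanCurvature P Q x‖ ^ 2 - sqNorm P (secondForm P Q) x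
        + sqNorm P (integrability P Q) x
        + ‖meanCurvature Q P x‖ ^ 2 - sqNorm Q (secondForm Q P) x
        + sqNorm Q (integrability Q P) x
        + divergence (fun y ↦ meanCurvature P Q y + meanCurvature Q P y) x := by
  obtain ⟨e, he, hex⟩ := h.smooth_left.exists_frame_onb x
  obtain ⟨f, hf, hfx⟩ := h.smooth_right.exists_frame_onb x
  have hfQ : ∀ i, ∀ᶠ y in 𝓝 x, f i y ∈ Q y := fun i ↦ hf.mem.mono fun y hy ↦ hy i
  have key := fun i ↦ h.sum_inner_curvatureField he hf (hf.smooth i) (hf.smooth i) (hfQ i) (hfQ i)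
  have hC := fun a ↦ congrArg (fun v ↦ ⟪v, e a x⟫) (h.symm.sum_covDeriv_frame hf (e a x))
  have hpsi : ∑ i, ∑ a, ∑ j, ⟪secondFund Q P x (f i x) (f j x), e a x⟫ *
      ⟪secondFund Q P x (f j x) (f i x), e a x⟫ = ∑ a, psi Q P x (onb P x a) (onb P x a) := by
    rw [Finset.sum_comm]
    refine Finset.sum_congr rfl fun a _ ↦ ?_
    simp only [hex, hfx]
    exact h.symm.sum_secondFund_mul_swap
  have hsum : mixedScalar P Q x = ∑ i, ∑ a, ⟪curvatureField (e a) (f i) (e a) x, f i x⟫ := by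
    rw [mixedScalar, Finset.sum_comm]
    refine Finset.sum_congr rfl fun i _ ↦ Finset.sum_congr rfl fun a _ ↦ ?_
    rw [← curvature_apply (he.smooth a) (hf.smooth i) (he.smooth a), hex, hfx]
  rw [hsum, Finset.sum_congr rfl fun i _ ↦ key i]
  simp only [Finset.sum_sub_distrib, Finset.sum_add_distrib]
  rw [hpsi, h.symm.sum_psi_onb, h.divergence_meanCurvature]
  simp only [hex, hfx] at hC ⊢
  simp only [h.sum_secondFund_mul_swap, h.sum_psi_onb]
  rw [Finset.sum_comm (f := fun i a ↦ ⟪leviCivita (fun y ↦ secondFund Q P y (f i y) (f i y)) x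
    (onb P x a) - secondFund Q P x (leviCivita (f i) x (onb P x a)) (onb Q x i)
    - secondFund Q P x (onb Q x i) (leviCivita (f i) x (onb P x a)), onb P x a⟫)]
  simp only [← sum_inner, hC]
  ring

end IsAdaptedPair

end StructureEquations

end

end AlmostProduct

theorem mainTheorem10
    {E : Type*} [NormedAddCommGroup E] [NormedSpace ℝ E] [FiniteDimensional ℝ E]
    {M : Type*} [TopologicalSpace M] [ChartedSpace E M] [IsManifold 𝓘(ℝ, E) ∞ M]
    [RiemannianBundle (fun x : M ↦ TangentSpace 𝓘(ℝ, E) x)]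
    [IsContMDiffRiemannianBundle 𝓘(ℝ, E) ∞ E (fun x : M ↦ TangentSpace 𝓘(ℝ, E) x)]
    (n p : ℕ) (Dt D : Π x : M, Submodule ℝ (TangentSpace 𝓘(ℝ, E) x))
    (hD : IsAdaptedPair n p Dt D) (x : M) :
    -- the identities for the partial Ricci tensor on `D`
    (∀ X ∈ D x, ∀ Y ∈ D x,
      partialRicci Dt D x X Y - divTensor (secondForm D Dt) x X Y
          - ⟪secondForm D Dt x X Y, meanCurvature D Dt x⟫
          + casoratiA D Dt x X Y + casoratiT D Dt x X Y
          + psi Dt D x X Y - deformation (meanCurvature Dt D) x X Y = 0 ∧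
      antisymDeriv (meanCurvature Dt D) x X Y
          + partialDivTensor Dt (integrability D Dt) x X Y - mixedAT D Dt x X Y = 0) ∧
    -- the dual identities for the partial Ricci tensor on `Dt`
    (∀ X ∈ Dt x, ∀ Y ∈ Dt x,
      partialRicci D Dt x X Y - divTensor (secondForm Dt D) x X Y
          - ⟪secondForm Dt D x X Y, meanCurvature Dt D x⟫
          + casoratiA Dt D x X Y + casoratiT Dt D x X Y
          + psi D Dt x X Y - deformation (meanCurvature D Dt) x X Y = 0 ∧
      antisymDeriv (meanCurvature D Dt) x X Y
          + partialDivTensor D (integrability Dt D) x X Y - mixedAT Dt D x X Y = 0) ∧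
    -- the formula for the mixed scalar curvature
    mixedScalar Dt D x =
      ‖meanCurvature Dt D x‖ ^ 2 - sqNorm Dt (secondForm Dt D) x
        + sqNorm Dt (integrability Dt D) x
        + ‖meanCurvature D Dt x‖ ^ 2 - sqNorm D (secondForm D Dt) x
        + sqNorm D (integrability D Dt) x
        + divergence (fun y ↦ meanCurvature Dt D y + meanCurvature D Dt y) x := by
  refine ⟨fun X hX Y hY ↦ ⟨hD.partialRicci_symm_part hX hY, hD.partialRicci_antisymm_part hX hY⟩,
    fun X hX Y hY ↦ ⟨hD.symm.partialRicci_symm_part hX hY,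
      hD.symm.partialRicci_antisymm_part hX hY⟩, hD.mixedScalar_eq x⟩
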